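/- **Generalized Helmholtz theorem in $E_n$.** Let $n\ge 3$, let $k\ge 0$, and let $S_{n-1}$ be the area of the unit sphere of the Euclidean space $E_n$. Let $\partial_h$ be the partial derivatives of the coefficients in Cartesian coordinates $x^1,\dots,x^n$, let $d\beta=dx^h\wedge\partial_h\beta$ be the exterior derivative and $\delta\beta=dx^h\cdot\partial_h\beta$ the interior derivative (contraction of $dx^h$ into the first slot; $\delta\beta=0$ for $0$-forms, so that $\delta=\partial_h\beta_h$ on $1$-forms and $d\delta+\delta d=\sum_h\partial_h^2$). Let $\omega^1,\dots,\omega^n$ be any constant orthonormal basis of the $1$-forms; for $A=\{i_1<\dots<i_j\}$ put $\omega^A=\omega^{i_1}\wedge\dots\wedge\omega^{i_j}$, and let $\omega^{\bar A}$ be the monomial (the complementary basis element with a sign) such that $\omega^A\wedge\omega^{\bar A}=z:=dx^1\wedge\dots\wedge dx^n$. Integrals over $E_n$ of forms of grade other than $n$ are $0$ by definition. For a form $\gamma$ put $$\omega^A I_A[\gamma](x)=\sum_A \omega^A\int_{E_n'}\frac{\gamma(x')\wedge\omega'^{\bar A}}{|x-x'|^{\,n-2}} .$$ Write $I_A^\delta=I_A[\delta\alpha]$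 and $I_A^d=I_A[d\alpha]$. 1. (Decomposition.) Let $\alpha$ be a differential $k$-form on $E_n$ of class $C^1$ such that $\alpha(x)\to0$ as $|x|\to\infty$ and such that the integrals $\int |\delta\alpha(x')|\,|x-x'|^{-(n-2)}dx'$ and $\int |d\alpha(x')|\,|x-x'|^{-(n-2)}dx'$ are finite for every $x$. Then $\omega^AI_A^\delta$ and $\omega^AI_A^d$ are of class $C^1$, and everywhere on $E_n$ $$\alpha=-\frac{1}{(n-2)S_{n-1}}\left[d(\omega^A I^\delta_A)+\delta(\omega^A I^d_A)\right].$$ If $\alpha$ is of class $C^2$, both terms $d(\omega^A I^\delta_A)$ and $\delta(\omega^A I^d_A)$ are of class $C^1$, the first is closed and the second is co-closed: $d\,d(\omega^A I^\delta_A)=0$ and $\delta\,\delta(\omega^A I^d_A)=0$. 2. (The system $d\alpha=\mu$, $\delta\alpha=\nu$.) Let $\mu$ be a $(k+1)$-form and $\nu$ a $(k-1)$-form ($\nu=0$ if $k=0$), both of class $C^1$ and $O((1+|x|)^{-s})$ for some $s>2$, with $d\mu=0$ and $\delta\nu=0$. Then $$\alpha=-\frac{1}{(n-2)S_{n-1}}\left[d(\omega^A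 I_A[\nu])+\delta(\omega^A I_A[\mu])\right]$$ is of class $C^1$, vanishes at infinity, and satisfies $d\alpha=\mu$ and $\delta\alpha=\nu$; and it is the only $k$-form of class $C^1$ vanishing at infinity with these two properties. -/

import Mathlib

open MeasureTheory Filter Topology

noncomputable section

namespace Kaehler

/-- The Euclidean space `E_n`. -/
abbrev Eucl (n : ℕ) : Type := EuclideanSpace ℝ (Fin n)

/-- Exterior forms of grade `j` on `E_n`; a differential `j`-form is a map `Eucl n → Form n j`. -/
abbrev Form (n j : ℕ) : Type := Eucl n [⋀^Fin j]→L[ℝ] ℝ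

/-- The standard frame `e_1, …, e_n` dual to the Cartesian `dx^1, …, dx^n`. -/
def stdFrame (n : ℕ) : OrthonormalBasis (Fin n) ℝ (Eucl n) := EuclideanSpace.basisFun (Fin n) ℝ

/-- Alternating maps on a finite-dimensional space are continuous. -/
theorem alternating_continuous {n j : ℕ} (f : Eucl n [⋀^Fin j]→ₗ[ℝ] ℝ) : Continuous f := by
  have h : ∀ v : Fin j → Eucl n, f v =
      ∑ r : Fin j → Fin n, (∏ i, v i (r i)) * f (fun i => stdFrame n (r i)) := by
    intro v
    have hv : v = fun i => ∑ l : Fin n, v i l • stdFrame n l := by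
      funext i
      conv_lhs => rw [← (stdFrame n).sum_repr (v i)]
      simp [stdFrame]
    calc f v = f.toMultilinearMap (fun i => ∑ l : Fin n, v i l • stdFrame n l) := by
            rw [← hv]; rfl
      _ = ∑ r : Fin j → Fin n, f.toMultilinearMap (fun i => v i (r i) • stdFrame n (r i)) :=
            f.toMultilinearMap.map_sum (fun i l => v i l • stdFrame n l)
      _ = _ := by
            refine Finset.sum_congr rfl fun r _ => ?_
            rw [f.toMultilinearMap.map_smul_univ (fun i => v i (r i)) (fun i => stdFrame n (r i))]
            rfl
  have h' : (f : (Fin j → Eucl n) → ℝ) = fun v =>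
      ∑ r : Fin j → Fin n, (∏ i, v i (r i)) * f (fun i => stdFrame n (r i)) := funext h
  rw [h']
  fun_prop

/-- An alternating map on `E_n`, regarded as an exterior form. -/
def toForm {n j : ℕ} (f : Eucl n [⋀^Fin j]→ₗ[ℝ] ℝ) : Form n j :=
  { f with cont := alternating_continuous f }

/-- The exterior product, normalized as a sum over shuffles. -/
def wedge {n p q : ℕ} (a : Form n p) (c : Form n q) : Form n (p + q) :=
  toForm (((LinearMap.mul' ℝ ℝ).compAlternatingMap
    (a.toAlternatingMap.domCoprod c.toAlternatingMap)).domDomCongr finSumFinEquiv)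

/-- The monomial `ω^{s 1} ∧ ⋯ ∧ ω^{s j}` in the 1-forms `ω^i = ⟪b i, ·⟫` dual to the orthonormal
basis `b`: its value at `(v_1, …, v_j)` is `det (ω^{s r} (v_l))`. -/
def monomial {n j : ℕ} (b : OrthonormalBasis (Fin n) ℝ (Eucl n)) (s : Fin j → Fin n) : Form n j :=
  toForm ((Matrix.detRowAlternating (n := Fin j) (R := ℝ)).compLinearMap
    (LinearMap.pi fun r => (innerₗ (Eucl n)) (b (s r))))

/-- The basis element `ω^A = ω^{i_1} ∧ ⋯ ∧ ω^{i_j}`, where `A = {i_1 < ⋯ < i_j}`. -/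
def basisForm {n j : ℕ} (b : OrthonormalBasis (Fin n) ℝ (Eucl n))
    (A : {A : Finset (Fin n) // A.card = j}) : Form n j :=
  monomial b (A.1.orderEmbOfFin A.2)

/-- The coefficient `f` of an `n`-form `f z`, where `z = dx^1 ∧ ⋯ ∧ dx^n`. Forms of another grade
have coefficient `0`, so that their integrals over `E_n` are `0`. -/
def topCoeff {n m : ℕ} (g : Form n m) : ℝ :=
  if h : m = n then g (fun i => stdFrame n (Fin.cast h i)) else 0

/-- The integral of an `m`-form over `E_n`, oriented by `z`; it is `0` by definition if `m ≠ n`. -/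
def formIntegral {n m : ℕ} (g : Eucl n → Form n m) : ℝ := ∫ y, topCoeff (g y)

/-- The monomial `ω^Ā` determined by `ω^A ∧ ω^Ā = z`: it is `± ω^{Aᶜ}`, and the sign is the
coefficient of `ω^A ∧ ω^{Aᶜ}`. -/
def complForm {n j : ℕ} (b : OrthonormalBasis (Fin n) ℝ (Eucl n))
    (A : {A : Finset (Fin n) // A.card = j}) : Form n (A.1ᶜ).card :=
  topCoeff (wedge (basisForm b A) (basisForm b ⟨A.1ᶜ, rfl⟩)) • basisForm b ⟨A.1ᶜ, rfl⟩

theorem wedge_monomial_apply {n p q : ℕ} (b : OrthonormalBasis (Fin n) ℝ (Eucl n))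
    (s : Fin p → Fin n) (t : Fin q → Fin n) (v : Fin (p + q) → Eucl n) :
    wedge (monomial b s) (monomial b t) v =
      (Matrix.of fun x y : Fin p ⊕ Fin q =>
        inner ℝ (b (Sum.elim s t y)) (v (finSumFinEquiv x))).det := by
  let P (j : ℕ) (u : Fin j → Fin n) : MultilinearMap ℝ (fun _ : Fin j => Eucl n) ℝ :=
    (MultilinearMap.mkPiAlgebra ℝ (Fin j) ℝ).compLinearMap
      (fun r => (innerₗ (Eucl n)) (b (u r)))
  have hP : ∀ (j : ℕ) (u : Fin j → Fin n),
      (monomial b u).toAlternatingMap = MultilinearMap.alternatization (P j u) := by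
    intro j u
    ext w
    rw [MultilinearMap.alternatization_apply]
    change Matrix.det (Matrix.of fun i r => inner ℝ (b (u r)) (w i)) = _
    rw [Matrix.det_apply]
    refine Finset.sum_congr rfl fun σ _ => ?_
    simp [P]
  have h1 : wedge (monomial b s) (monomial b t) v =
      (LinearMap.mul' ℝ ℝ) (((monomial b s).toAlternatingMap.domCoprod
        (monomial b t).toAlternatingMap) (fun x => v (finSumFinEquiv x))) := rfl
  rw [h1, hP, hP, ← MultilinearMap.domCoprod_alternization,
    MultilinearMap.alternatization_apply, map_sum, Matrix.det_apply]
  refine Finset.sum_congr rfl fun σ _ => ?_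
  rw [Units.smul_def, Units.smul_def, map_zsmul]
  simp [P]

/-- The defining property `ω^A ∧ ω^Ā = z`. -/
theorem basisForm_wedge_complForm {n j : ℕ} (b : OrthonormalBasis (Fin n) ℝ (Eucl n))
    (A : {A : Finset (Fin n) // A.card = j}) :
    topCoeff (wedge (basisForm b A) (complForm b A)) = 1 := by
  obtain ⟨A, rfl⟩ := A
  have hn : A.card + (Aᶜ).card = n := by simp
  have hs : ∀ (c : ℝ) (g : Form n A.card) (g' : Form n (Aᶜ).card),
      topCoeff (wedge g (c • g')) = c * topCoeff (wedge g g') := by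
    intro c g g'
    have : wedge g (c • g') = c • wedge g g' := by
      ext v
      change (LinearMap.mul' ℝ ℝ) ((g.toAlternatingMap.domCoprod
        (c • g'.toAlternatingMap)) (fun x => v (finSumFinEquiv x))) = c * (LinearMap.mul' ℝ ℝ)
          ((g.toAlternatingMap.domCoprod g'.toAlternatingMap) (fun x => v (finSumFinEquiv x)))
      rw [← AlternatingMap.domCoprod'_apply, TensorProduct.tmul_smul, map_smul]
      simp
    simp [topCoeff, hn, this]
  rw [complForm, hs]
  have hd : topCoeff (wedge (basisForm b ⟨A, rfl⟩) (basisForm b ⟨Aᶜ, rfl⟩)) =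
      (Matrix.of fun x y : Fin A.card ⊕ Fin (Aᶜ).card =>
        inner ℝ (b (finSumEquivOfFinset rfl rfl y))
          (stdFrame n (Fin.cast hn (finSumFinEquiv x)))).det := by
    rw [topCoeff, dif_pos hn, basisForm, basisForm, wedge_monomial_apply]
    congr 1
    ext x y
    cases y <;> rfl
  rw [hd]
  set M := Matrix.of fun x y : Fin A.card ⊕ Fin (Aᶜ).card =>
        inner ℝ (b (finSumEquivOfFinset (s := A) rfl rfl y))
          (stdFrame n (Fin.cast hn (finSumFinEquiv x))) with hM
  have hMM : M.transpose * M = 1 := by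
    ext x y
    rw [Matrix.mul_apply]
    simp only [hM, Matrix.transpose_apply, Matrix.of_apply]
    refine (Equiv.sum_comp (finSumFinEquiv.trans (finCongr hn)) (fun l : Fin n =>
      inner ℝ (b (finSumEquivOfFinset (s := A) rfl rfl x)) (stdFrame n l) *
      inner ℝ (b (finSumEquivOfFinset (s := A) rfl rfl y)) (stdFrame n l))).trans ?_
    simp_rw [fun l => real_inner_comm (stdFrame n l)
      (b (finSumEquivOfFinset (s := A) rfl rfl y))]
    rw [(stdFrame n).sum_inner_mul_inner, OrthonormalBasis.inner_eq_ite, Matrix.one_apply]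
    simp
  have := congrArg Matrix.det hMM
  rwa [Matrix.det_mul, Matrix.det_transpose, Matrix.det_one] at this

/-- The interior derivative `δβ = dx^h · ∂_h β` (contraction of `dx^h` into the first slot) of a
form of positive grade. -/
def delta {n j : ℕ} (β : Eucl n → Form n (j + 1)) (x : Eucl n) : Form n j :=
  ∑ h : Fin n, (fderiv ℝ β x (stdFrame n h)).curryLeft (stdFrame n h)

/-- The interior derivative from grade `k` to grade `k - 1`; it is `0` on `0`-forms. -/
def interiorDeriv {n : ℕ} : (k : ℕ) → (Eucl n → Form n k) → (Eucl n → Form n (k - 1))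
  | 0, _ => 0
  | _ + 1, β => delta β

/-- The exterior derivative from grade `k - 1` to grade `k`. For `k = 0` there are no
`(k - 1)`-forms, and the value is `0`. -/
def exteriorDerivTo {n : ℕ} : (k : ℕ) → (Eucl n → Form n (k - 1)) → (Eucl n → Form n k)
  | 0, _ => 0
  | _ + 1, β => extDeriv β

/-- `I_A(x) = ∫ γ' ∧ ω'^Ā / r₁₂^{n-2}` with `r₁₂ = ‖x - x'‖`. -/
def potentialCoeff {n j : ℕ} (b : OrthonormalBasis (Fin n) ℝ (Eucl n)) (γ : Eucl n → Form n j)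
    (A : {A : Finset (Fin n) // A.card = j}) (x : Eucl n) : ℝ :=
  formIntegral fun y => (1 / ‖x - y‖ ^ (n - 2)) • wedge (γ y) (complForm b A)

/-- The `j`-form `ω^A I_A`, summed over the basis. For a `j`-form `γ` the integrals `I_A` with
`|A| ≠ j` are integrals of forms of grade other than `n`, that is, `0`. -/
def potential {n j : ℕ} (b : OrthonormalBasis (Fin n) ℝ (Eucl n)) (γ : Eucl n → Form n j)
    (x : Eucl n) : Form n j :=
  ∑ A : {A : Finset (Fin n) // A.card = j}, potentialCoeff b γ A x • basisForm b A

/-- Absolute convergence at every point of the integrals `∫ γ' / r₁₂^{n-2}`. -/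
def PotentialConverges {n j : ℕ} (γ : Eucl n → Form n j) : Prop :=
  ∀ x : Eucl n, Integrable fun y : Eucl n => ‖γ y‖ / ‖x - y‖ ^ (n - 2)

/-- `γ(x) → 0` as `|x| → ∞`. -/
def VanishesAtInfinity {n j : ℕ} (γ : Eucl n → Form n j) : Prop :=
  Tendsto γ (cocompact (Eucl n)) (𝓝 0)

/-- `γ(x) = O((1 + |x|)^{-s})` for some `s > 2`. -/
def DecaysFasterThanInverseSquare {n j : ℕ} (γ : Eucl n → Form n j) : Prop :=
  ∃ s : ℝ, 2 < s ∧ ∃ C : ℝ, ∀ x : Eucl n, ‖γ x‖ ≤ C * (1 + ‖x‖) ^ (-s)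

/-- The area `S_{n-1}` of the unit sphere of `E_n`. -/
def sphereArea (n : ℕ) : ℝ := (volume : Measure (Eucl n)).toSphere.real Set.univ

/-- `-1/((n-2) S_{n-1}) [d(ω^A I_A^δ) + δ(ω^A I_A^d)]`, where `I_A^δ` and `I_A^d` are formed with
`ν` in the place of `δα` and with `μ` in the place of `dα`. -/
def helmholtzForm {n : ℕ} (b : OrthonormalBasis (Fin n) ℝ (Eucl n)) (k : ℕ)
    (ν : Eucl n → Form n (k - 1)) (μ : Eucl n → Form n (k + 1)) (x : Eucl n) : Form n k :=
  (-(1 / (((n : ℝ) - 2) * sphereArea n))) •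
    (exteriorDerivTo k (potential b ν) x + delta (potential b μ) x)

end Kaehler

end

/-!
The proof rests on the Newtonian potential `N γ (x) = ∫ γ(y) |x - y|^{-(n-2)} dy` of a form-valued
density `γ`. The coefficient of `γ ∧ ω^Ā` is the component of `γ` along `ω^A`
(`topCoeff_wedge_complForm`), so `ω^A I_A[γ]` is `N γ`, whatever the basis
(`potential_eq_newtonPotential`).

*Poisson's equation.* The kernel is split as `nearKernel + farKernel`, where the far part is smooth
and the near part has compact support. If the integrals converge absolutely, then `N γ` is of class
`C^1` for continuous `γ` and of class `C^2` for `γ` of class `C^1`: derivatives fall on the far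
kernel and, in the near part, one of them on the kernel and one on `γ`. When the splitting radius
tends to `0`, the near part drops out and the Laplacian of the far kernel, supported in a small
ball and of integral `-(n-2) S_{n-1}` (`integral_laplacian_farKernel`), concentrates at the origin.
Hence `Δ N γ = -(n-2) S_{n-1} γ` (`laplacian_newtonPotential`).

*Decomposition.* For a form `β` of class `C^1` and of compact support, `N (dβ) = d (N β)` and
`N (δβ) = δ (N β)`, so that `d N (δβ) + δ N (dβ) = (dδ + δd) N β = Δ N β` is
`-(n-2) S_{n-1} β`. Let `β = χ_k α`, where `χ_k` is a cutoff at radius `k + 1`, and `k → ∞`. The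
derivatives of `χ_k` are `O(1/k)` on a shell of radius comparable to `k`, the gradient of the kernel
is `O(k^{-(n-1)})` there, and the volume of the shell is `O(k^n)`; as `α → 0` at infinity, their
contribution vanishes in the limit (`tendsto_fderiv_newtonPotential_boundary`). What remains is the
decomposition of `α` (`exteriorDerivTo_add_delta_newtonPotential`). It shows that a closed and
co-closed form vanishing at infinity is `0`, which is the uniqueness statement.

*The system.* If `γ` satisfies a first-order equation with constant coefficients, so does `N γ`
(`comp_fderiv_newtonPotential_eq_zero`, again by cutoffs). So `d N μ = 0` and `δ N ν = 0`, and
`dδ N μ = Δ N μ`, `δd N ν = Δ N ν`; together with `dd = 0` and `δδ = 0` this solves `dα = μ`,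
`δα = ν`. The solution vanishes at infinity because the gradient of the potential of a density
which is `O((1 + |x|)^{-s})`, `s > 2`, does (`tendsto_fderiv_newtonPotential_of_decay`).
-/

noncomputable section

namespace Kaehler

open scoped Convolution
open ContinuousLinearMap (lsmul)

/-! ### Convolutions with a dominated kernel -/

section Dominated

variable {E W F G : Type*} [NormedAddCommGroup E] [NormedSpace ℝ E] [MeasurableSpace E]
  [BorelSpace E] [SecondCountableTopology E] [NormedAddCommGroup W] [NormedSpace ℝ W]
  [NormedAddCommGroup F] [NormedSpace ℝ F] [NormedAddCommGroup G] [NormedSpace ℝ G]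
  {μ : Measure E} {f : E → W} {g : E → F}

/-- The integrands `t ↦ f t * g (x - t)` of a convolution are dominated by an integrable function,
locally uniformly in `x`. -/
def ConvDominated (μ : Measure E) (f : E → W) (g : E → F) : Prop :=
  ∀ x₀, ∃ h : E → ℝ, Integrable h μ ∧ ∀ x ∈ Metric.ball x₀ 1, ∀ t, ‖f t‖ * ‖g (x - t)‖ ≤ h t

theorem convolutionIntegrand_norm_le (L : W →L[ℝ] F →L[ℝ] G) {a : W} {c : F} {r : ℝ}
    (h : ‖a‖ * ‖c‖ ≤ r) : ‖L a c‖ ≤ ‖L‖ * r := by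
  refine (L.le_opNorm₂ a c).trans ?_
  rw [mul_assoc]
  gcongr

omit [NormedSpace ℝ E] in
theorem aestronglyMeasurable_convolutionIntegrand (L : W →L[ℝ] F →L[ℝ] G)
    (hf : AEStronglyMeasurable f μ) (hg : Continuous g) (x : E) :
    AEStronglyMeasurable (fun t => L (f t) (g (x - t))) μ :=
  L.aestronglyMeasurable_comp₂ hf
    (hg.comp (continuous_const.sub continuous_id)).aestronglyMeasurable

omit [NormedSpace ℝ E] in
theorem ConvDominated.convolutionExistsAt (h : ConvDominated μ f g) (L : W →L[ℝ] F →L[ℝ] G)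
    (hf : AEStronglyMeasurable f μ) (hg : Continuous g) (x : E) :
    ConvolutionExistsAt f g x L μ := by
  obtain ⟨k, hk, hle⟩ := h x
  refine (hk.const_mul ‖L‖).mono' (aestronglyMeasurable_convolutionIntegrand L hf hg x) ?_
  exact Eventually.of_forall fun t =>
    convolutionIntegrand_norm_le L (hle x (Metric.mem_ball_self one_pos) t)

omit [NormedSpace ℝ E] in
theorem ConvDominated.continuous_convolution (h : ConvDominated μ f g) (L : W →L[ℝ] F →L[ℝ] G)
    (hf : AEStronglyMeasurable f μ) (hg : Continuous g) : Continuous (f ⋆[L, μ] g) := by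
  refine continuous_iff_continuousAt.2 fun x₀ => ?_
  obtain ⟨k, hk, hle⟩ := h x₀
  refine continuousAt_of_dominated (bound := fun t => ‖L‖ * k t)
    (Eventually.of_forall fun x => aestronglyMeasurable_convolutionIntegrand L hf hg x) ?_
    (hk.const_mul _) ?_
  · filter_upwards [Metric.ball_mem_nhds x₀ one_pos] with x hx
    exact Eventually.of_forall fun t => convolutionIntegrand_norm_le L (hle x hx t)
  · exact Eventually.of_forall fun t => by fun_prop

/-- A dominated convolution may be differentiated in its second factor. -/
theorem ConvDominated.hasFDerivAt_convolution (h : ConvDominated μ f g)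
    (h' : ConvDominated μ f (fderiv ℝ g)) (L : W →L[ℝ] F →L[ℝ] G)
    (hf : AEStronglyMeasurable f μ) (hg : ContDiff ℝ 1 g) (x₀ : E) :
    HasFDerivAt (f ⋆[L, μ] g) ((f ⋆[L.precompR E, μ] fderiv ℝ g) x₀) x₀ := by
  obtain ⟨k, hk, hle⟩ := h' x₀
  have hg' := hg.continuous_fderiv one_ne_zero
  refine hasFDerivAt_integral_of_dominated_of_fderiv_le (bound := fun t => ‖L‖ * k t)
    (F' := fun x t => L.precompR E (f t) (fderiv ℝ g (x - t)))
    (Metric.ball_mem_nhds x₀ one_pos)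
    (Eventually.of_forall fun x => aestronglyMeasurable_convolutionIntegrand L hf hg.continuous x)
    (h.convolutionExistsAt L hf hg.continuous x₀)
    (aestronglyMeasurable_convolutionIntegrand (L.precompR E) hf hg' x₀) ?_
    (hk.const_mul _) ?_
  · refine Eventually.of_forall fun t x hx => ?_
    calc ‖(L (f t)).comp (fderiv ℝ g (x - t))‖
        ≤ ‖L (f t)‖ * ‖fderiv ℝ g (x - t)‖ := ContinuousLinearMap.opNorm_comp_le _ _
      _ ≤ ‖L‖ * ‖f t‖ * ‖fderiv ℝ g (x - t)‖ := by gcongr; exact L.le_opNorm _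
      _ ≤ ‖L‖ * k t := by rw [mul_assoc]; gcongr; exact hle x hx t
  · refine Eventually.of_forall fun t x _ => (L (f t)).hasFDerivAt.comp x ?_
    exact (hasFDerivAt_comp_sub t).2 (hg.differentiable one_ne_zero (x - t)).hasFDerivAt

theorem ConvDominated.differentiable_convolution (h : ConvDominated μ f g)
    (h' : ConvDominated μ f (fderiv ℝ g)) (L : W →L[ℝ] F →L[ℝ] G)
    (hf : AEStronglyMeasurable f μ) (hg : ContDiff ℝ 1 g) : Differentiable ℝ (f ⋆[L, μ] g) :=
  fun x => (h.hasFDerivAt_convolution h' L hf hg x).differentiableAt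

theorem ConvDominated.fderiv_convolution_apply [CompleteSpace G] (h : ConvDominated μ f g)
    (h' : ConvDominated μ f (fderiv ℝ g)) (L : W →L[ℝ] F →L[ℝ] G)
    (hf : AEStronglyMeasurable f μ) (hg : ContDiff ℝ 1 g) (x v : E) :
    fderiv ℝ (f ⋆[L, μ] g) x v = (f ⋆[L, μ] fun z => fderiv ℝ g z v) x := by
  rw [(h.hasFDerivAt_convolution h' L hf hg x).fderiv]
  exact ContinuousLinearMap.integral_apply (h'.convolutionExistsAt (L.precompR E) hf
    (hg.continuous_fderiv one_ne_zero) x) v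

omit [BorelSpace E] [SecondCountableTopology E] [NormedSpace ℝ W] in
theorem ConvDominated.fderiv_apply (h : ConvDominated μ f (fderiv ℝ g)) (v : E) :
    ConvDominated μ f (fun z => fderiv ℝ g z v) := by
  intro x₀
  obtain ⟨k, hk, hle⟩ := h x₀
  refine ⟨fun t => k t * ‖v‖, hk.mul_const _, fun x hx t => ?_⟩
  calc ‖f t‖ * ‖fderiv ℝ g (x - t) v‖ ≤ ‖f t‖ * (‖fderiv ℝ g (x - t)‖ * ‖v‖) := by
        gcongr; exact (fderiv ℝ g (x - t)).le_opNorm v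
    _ ≤ k t * ‖v‖ := by rw [← mul_assoc]; gcongr; exact hle x hx t

omit [NormedSpace ℝ E] [SecondCountableTopology E] [NormedSpace ℝ W] [NormedSpace ℝ F] in
/-- Convolutions of a locally integrable function with a continuous function of compact support
are dominated. -/
theorem convDominated_of_hasCompactSupport_right [ProperSpace E] (hf : LocallyIntegrable f μ)
    (hg : Continuous g) (hgs : HasCompactSupport g) : ConvDominated μ f g := by
  intro x₀
  obtain ⟨C, hC⟩ := hgs.exists_bound_of_continuous hg
  let S : Set E := (fun p : E × E => p.1 - p.2) '' (Metric.closedBall x₀ 1 ×ˢ tsupport g)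
  have hS : IsCompact S :=
    ((isCompact_closedBall x₀ 1).prod hgs).image (continuous_fst.sub continuous_snd)
  refine ⟨S.indicator fun t => ‖f t‖ * C, ?_, fun x hx t => ?_⟩
  · rw [integrable_indicator_iff hS.isClosed.measurableSet]
    exact ((hf.integrableOn_isCompact hS).norm).mul_const C
  · by_cases ht : t ∈ S
    · rw [Set.indicator_of_mem ht]
      gcongr
      exact hC _
    · have : g (x - t) = 0 := by
        by_contra hne
        exact ht ⟨(x, x - t), ⟨Metric.ball_subset_closedBall hx,
          subset_tsupport g (Function.mem_support.2 hne)⟩, by simp⟩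
      rw [Set.indicator_of_notMem ht, this]
      simp

omit [NormedSpace ℝ E] [BorelSpace E] [SecondCountableTopology E] [NormedSpace ℝ W]
  [NormedSpace ℝ F] in
/-- Convolutions of an integrable function of bounded support with a continuous function are
dominated. -/
theorem convDominated_of_bounded_support_left [ProperSpace E] (hf : Integrable f μ) {r : ℝ}
    (hfs : ∀ t, r < ‖t‖ → f t = 0) (hg : Continuous g) : ConvDominated μ f g := by
  intro x₀
  obtain ⟨C, hC⟩ := (isCompact_closedBall x₀ (1 + r)).exists_bound_of_continuousOn hg.continuousOn
  refine ⟨fun t => ‖f t‖ * C, hf.norm.mul_const C, fun x hx t => ?_⟩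
  rcases lt_or_ge r ‖t‖ with ht | ht
  · simp [hfs t ht]
  · refine mul_le_mul_of_nonneg_left (hC _ ?_) (norm_nonneg _)
    rw [Metric.mem_closedBall, dist_eq_norm]
    rw [Metric.mem_ball, dist_eq_norm] at hx
    calc ‖x - t - x₀‖ = ‖(x - x₀) - t‖ := by congr 1; abel
      _ ≤ ‖x - x₀‖ + ‖t‖ := norm_sub_le _ _
      _ ≤ 1 + r := by linarith

end Dominated

/-! ### The Newtonian kernel and its splitting into a near and a far part -/

section Kernel

variable {n : ℕ}

/-- The kernel `|z|^{-(n-2)}` of the Newtonian potential, without the usual normalization. For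
`n ≥ 3` its value at the origin is `0`, which is of no consequence for the integrals. -/
def newtonKernel (n : ℕ) (z : Eucl n) : ℝ := 1 / ‖z‖ ^ (n - 2)

theorem hasFDerivAt_norm_pow_inv (m : ℕ) {z : Eucl n} (hz : z ≠ 0) :
    HasFDerivAt (fun y : Eucl n => (‖y‖ ^ m)⁻¹)
      ((-(m : ℝ) * (‖z‖ ^ (m + 2))⁻¹) • innerSL ℝ z) z := by
  have hz0 : ‖z‖ ≠ 0 := norm_ne_zero_iff.2 hz
  have h1 : HasFDerivAt (fun y : Eucl n => ‖y‖) ((‖z‖⁻¹) • innerSL ℝ z) z := by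
    have h := (hasStrictFDerivAt_norm_sq z).hasFDerivAt.sqrt (by positivity)
    have e : (fun y : Eucl n => √(‖y‖ ^ 2)) = fun y => ‖y‖ := by
      funext y; exact Real.sqrt_sq (norm_nonneg y)
    rw [e, Real.sqrt_sq (norm_nonneg z)] at h
    refine h.congr_fderiv ?_
    ext v
    simp
    ring
  have h2 : HasDerivAt (fun t : ℝ => (t ^ m)⁻¹) (-(m : ℝ) * (‖z‖ ^ (m + 1))⁻¹) ‖z‖ := by
    refine ((hasDerivAt_inv (pow_ne_zero m hz0)).comp ‖z‖ (hasDerivAt_pow m ‖z‖)).congr_deriv ?_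
    rcases m with _ | m
    · simp
    · simp only [Nat.add_sub_cancel]
      field_simp
      ring
  refine (h2.comp_hasFDerivAt z h1).congr_fderiv ?_
  ext v
  simp
  field_simp
  ring

theorem contDiffAt_newtonKernel {z : Eucl n} (hz : z ≠ 0) (k : WithTop ℕ∞) :
    ContDiffAt ℝ k (newtonKernel n) z := by
  unfold newtonKernel
  exact contDiffAt_const.div ((contDiffAt_norm ℝ hz).pow _)
    (pow_ne_zero _ (norm_ne_zero_iff.2 hz))

theorem fderiv_newtonKernel (hn : 2 ≤ n) {z : Eucl n} (hz : z ≠ 0) :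
    fderiv ℝ (newtonKernel n) z = (-((n : ℝ) - 2) * (‖z‖ ^ n)⁻¹) • innerSL ℝ z := by
  have h := hasFDerivAt_norm_pow_inv (n - 2) hz
  rw [Nat.sub_add_cancel hn, Nat.cast_sub hn] at h
  have e : newtonKernel n = fun y => (‖y‖ ^ (n - 2))⁻¹ := by
    funext y; simp [newtonKernel]
  rw [e, h.fderiv]
  norm_num

theorem fderiv_fderiv_newtonKernel (hn : 2 ≤ n) {z : Eucl n} (hz : z ≠ 0) (v w : Eucl n) :
    fderiv ℝ (fun y => fderiv ℝ (newtonKernel n) y w) z v =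
      -((n : ℝ) - 2) * ((‖z‖ ^ n)⁻¹ * inner ℝ v w
        - n * (‖z‖ ^ (n + 2))⁻¹ * inner ℝ z v * inner ℝ z w) := by
  have e : (fun y => fderiv ℝ (newtonKernel n) y w) =ᶠ[𝓝 z]
      fun y => -((n : ℝ) - 2) * ((‖y‖ ^ n)⁻¹ * innerSL ℝ w y) := by
    filter_upwards [isOpen_ne.mem_nhds hz] with y hy
    rw [fderiv_newtonKernel hn hy]
    simp [real_inner_comm, mul_assoc]
  have h := ((hasFDerivAt_norm_pow_inv n hz).mul (innerSL ℝ w).hasFDerivAt).const_mul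
    (-((n : ℝ) - 2))
  rw [e.fderiv_eq]
  refine (congrArg (fun T : Eucl n →L[ℝ] ℝ => T v) h.fderiv).trans ?_
  simp [real_inner_comm]
  ring

/-- The Laplacian, as the sum of the second derivatives along the standard frame. -/
def laplacian {F : Type*} [NormedAddCommGroup F] [NormedSpace ℝ F] (f : Eucl n → F)
    (x : Eucl n) : F :=
  ∑ h : Fin n, fderiv ℝ (fun y => fderiv ℝ f y (stdFrame n h)) x (stdFrame n h)

theorem sum_inner_stdFrame_mul_self (z : Eucl n) :
    ∑ h : Fin n, inner ℝ z (stdFrame n h) * inner ℝ z (stdFrame n h) = ‖z‖ ^ 2 := by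
  rw [← real_inner_self_eq_norm_sq, ← (stdFrame n).sum_inner_mul_inner z z]
  exact Finset.sum_congr rfl fun h _ => by rw [real_inner_comm z]

theorem laplacian_newtonKernel (hn : 2 ≤ n) {z : Eucl n} (hz : z ≠ 0) :
    laplacian (newtonKernel n) z = 0 := by
  have hz0 : ‖z‖ ≠ 0 := norm_ne_zero_iff.2 hz
  have hs := sum_inner_stdFrame_mul_self z
  have h1 : ∀ h : Fin n, inner ℝ (stdFrame n h) (stdFrame n h) = (1 : ℝ) := fun h => by
    rw [real_inner_self_eq_norm_sq, (stdFrame n).norm_eq_one, one_pow]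
  simp only [laplacian, fderiv_fderiv_newtonKernel hn hz, h1]
  rw [← Finset.mul_sum, Finset.sum_sub_distrib]
  simp only [mul_assoc, ← Finset.mul_sum, hs]
  have : (n : ℝ) * ((‖z‖ ^ (n + 2))⁻¹ * ‖z‖ ^ 2) = n * (‖z‖ ^ n)⁻¹ := by
    rw [pow_add]
    field_simp
  rw [this]
  simp [mul_comm]

/-- A smooth radial cutoff: it is `1` on the unit ball and vanishes where `|z|² ≥ 2`. -/
def cutoff (z : Eucl n) : ℝ := Real.smoothTransition (2 - ‖z‖ ^ 2)

theorem contDiff_cutoff (k : ℕ∞) : ContDiff ℝ k (cutoff (n := n)) :=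
  Real.smoothTransition.contDiff.comp (contDiff_const.sub (contDiff_norm_sq ℝ))

theorem cutoff_eq_one {z : Eucl n} (hz : ‖z‖ ≤ 1) : cutoff z = 1 :=
  Real.smoothTransition.one_of_one_le (by nlinarith [norm_nonneg z])

theorem cutoff_eq_zero {z : Eucl n} (hz : 2 ≤ ‖z‖ ^ 2) : cutoff z = 0 :=
  Real.smoothTransition.zero_of_nonpos (by linarith)

theorem cutoff_mem_Icc (z : Eucl n) : cutoff z ∈ Set.Icc (0 : ℝ) 1 :=
  ⟨Real.smoothTransition.nonneg _, Real.smoothTransition.le_one _⟩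

theorem hasCompactSupport_cutoff : HasCompactSupport (cutoff (n := n)) := by
  refine HasCompactSupport.intro (isCompact_closedBall 0 2) fun z hz => cutoff_eq_zero ?_
  rw [mem_closedBall_zero_iff, not_le] at hz
  nlinarith

/-- The part of the Newtonian kernel concentrated in the ball of radius `1 / c`. -/
def nearKernel (n : ℕ) (c : ℝ) (z : Eucl n) : ℝ := cutoff ((2 * c) • z) * newtonKernel n z

/-- The smooth remainder of the Newtonian kernel, which agrees with it outside of the ball of
radius `1 / c`. -/
def farKernel (n : ℕ) (c : ℝ) (z : Eucl n) : ℝ := newtonKernel n z - nearKernel n c z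

theorem nearKernel_eq_zero {c : ℝ} (hc : 0 < c) {z : Eucl n} (hz : c⁻¹ ≤ ‖z‖) :
    nearKernel n c z = 0 := by
  have h : 1 ≤ c * ‖z‖ := by
    calc 1 = c * c⁻¹ := (mul_inv_cancel₀ hc.ne').symm
      _ ≤ c * ‖z‖ := by gcongr
  rw [nearKernel, cutoff_eq_zero, zero_mul]
  rw [norm_smul, Real.norm_of_nonneg (by positivity)]
  nlinarith

theorem fderiv_nearKernel_eq_zero {c : ℝ} (hc : 0 < c) {z : Eucl n} (hz : c⁻¹ < ‖z‖) :
    fderiv ℝ (nearKernel n c) z = 0 := by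
  have : nearKernel n c =ᶠ[𝓝 z] fun _ => 0 := by
    filter_upwards [(isOpen_lt continuous_const continuous_norm).mem_nhds hz] with y hy
    exact nearKernel_eq_zero hc (le_of_lt hy)
  rw [this.fderiv_eq]
  simp

theorem contDiffAt_nearKernel (c : ℝ) {z : Eucl n} (hz : z ≠ 0) (k : ℕ∞) :
    ContDiffAt ℝ k (nearKernel n c) z :=
  (((contDiff_cutoff k).comp (contDiff_const_smul (2 * c))).contDiffAt).mul
    (contDiffAt_newtonKernel hz k)

theorem contDiff_farKernel {c : ℝ} (hc : 0 < c) (k : ℕ∞) : ContDiff ℝ k (farKernel n c) := by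
  refine contDiff_iff_contDiffAt.2 fun z => ?_
  rcases eq_or_ne z 0 with rfl | hz
  · have : farKernel n c =ᶠ[𝓝 0] fun _ => 0 := by
      filter_upwards [Metric.ball_mem_nhds (0 : Eucl n) (show 0 < (2 * c)⁻¹ by positivity)]
        with y hy
      have h1 : ‖(2 * c) • y‖ ≤ 1 := by
        rw [norm_smul, Real.norm_of_nonneg (by positivity)]
        rw [mem_ball_zero_iff] at hy
        calc 2 * c * ‖y‖ ≤ 2 * c * (2 * c)⁻¹ := by gcongr
          _ = 1 := mul_inv_cancel₀ (by positivity)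
      rw [farKernel, nearKernel, cutoff_eq_one h1]
      ring
    exact contDiffAt_const.congr_of_eventuallyEq this
  · exact (contDiffAt_newtonKernel hz k).sub (contDiffAt_nearKernel c hz k)

theorem newtonKernel_smul {c : ℝ} (hc : 0 < c) (z : Eucl n) :
    newtonKernel n z = c ^ (n - 2) * newtonKernel n (c • z) := by
  rw [newtonKernel, newtonKernel, norm_smul, Real.norm_of_nonneg hc.le, mul_pow]
  have : c ^ (n - 2) ≠ 0 := by positivity
  rcases eq_or_ne (‖z‖ ^ (n - 2)) 0 with h | h
  · simp [h]
  · field_simp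

theorem nearKernel_smul {c : ℝ} (hc : 0 < c) (z : Eucl n) :
    nearKernel n c z = c ^ (n - 2) * nearKernel n 1 (c • z) := by
  rw [nearKernel, nearKernel, newtonKernel_smul hc z, smul_smul]
  ring_nf

theorem farKernel_smul {c : ℝ} (hc : 0 < c) (z : Eucl n) :
    farKernel n c z = c ^ (n - 2) * farKernel n 1 (c • z) := by
  rw [farKernel, farKernel, nearKernel_smul hc, newtonKernel_smul hc z]
  ring

theorem fderiv_comp_smul_mul (a c : ℝ) (f : Eucl n → ℝ) (z : Eucl n) :
    fderiv ℝ (fun y => a * f (c • y)) z = (a * c) • fderiv ℝ f (c • z) := by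
  have h := congrFun (fderiv_const_smul_field (𝕜 := ℝ) (f := fun y => f (c • y)) a) z
  rw [Pi.smul_apply, fderiv_comp_smul, smul_smul] at h
  exact h

theorem fderiv_nearKernel_smul {c : ℝ} (hc : 0 < c) (z : Eucl n) :
    fderiv ℝ (nearKernel n c) z = (c ^ (n - 2) * c) • fderiv ℝ (nearKernel n 1) (c • z) := by
  rw [funext (nearKernel_smul hc), fderiv_comp_smul_mul]

theorem laplacian_farKernel_smul (hn : 2 ≤ n) {c : ℝ} (hc : 0 < c) (z : Eucl n) :
    laplacian (farKernel n c) z = c ^ n * laplacian (farKernel n 1) (c • z) := by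
  rw [laplacian, laplacian, Finset.mul_sum]
  refine Finset.sum_congr rfl fun h _ => ?_
  have e : (fun y => fderiv ℝ (farKernel n c) y (stdFrame n h)) =
      fun y => (c ^ (n - 2) * c) *
        (fun u => fderiv ℝ (farKernel n 1) u (stdFrame n h)) (c • y) := by
    funext y
    rw [funext (farKernel_smul hc), fderiv_comp_smul_mul]
    rfl
  rw [e, fderiv_comp_smul_mul (c ^ (n - 2) * c) c
    (fun u => fderiv ℝ (farKernel n 1) u (stdFrame n h)) z]
  have : c ^ n = c ^ (n - 2) * c * c := by
    rw [mul_assoc, ← pow_two, ← pow_add, Nat.sub_add_cancel hn]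
  rw [this]
  rfl

theorem farKernel_eventuallyEq {c : ℝ} (hc : 0 < c) {z : Eucl n} (hz : c⁻¹ < ‖z‖) :
    farKernel n c =ᶠ[𝓝 z] newtonKernel n := by
  filter_upwards [(isOpen_lt continuous_const continuous_norm).mem_nhds hz] with y hy
  rw [farKernel, nearKernel_eq_zero hc (le_of_lt hy), sub_zero]

theorem laplacian_farKernel_eq_zero (hn : 2 ≤ n) {c : ℝ} (hc : 0 < c) {z : Eucl n}
    (hz : c⁻¹ < ‖z‖) : laplacian (farKernel n c) z = 0 := by
  have hz0 : z ≠ 0 := norm_pos_iff.1 ((inv_pos.2 hc).trans hz)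
  rw [← laplacian_newtonKernel hn hz0]
  refine Finset.sum_congr rfl fun h _ => ?_
  have : (fun y => fderiv ℝ (farKernel n c) y (stdFrame n h)) =ᶠ[𝓝 z]
      fun y => fderiv ℝ (newtonKernel n) y (stdFrame n h) := by
    filter_upwards [(farKernel_eventuallyEq hc hz).fderiv (𝕜 := ℝ)] with y hy
    rw [hy]
  rw [this.fderiv_eq]

theorem contDiff_fderiv_farKernel {c : ℝ} (hc : 0 < c) (k : ℕ) (v : Eucl n) :
    ContDiff ℝ k (fun z => fderiv ℝ (farKernel n c) z v) :=
  ((contDiff_farKernel hc (k + 1 : ℕ)).fderiv_right (m := k) (by push_cast; rfl)).clm_apply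
    contDiff_const

theorem continuous_laplacian_farKernel {c : ℝ} (hc : 0 < c) :
    Continuous (laplacian (farKernel n c)) := by
  unfold laplacian
  refine continuous_finsetSum _ fun h _ => ?_
  have := (contDiff_fderiv_farKernel hc 1 (stdFrame n h)).continuous_fderiv one_ne_zero
  fun_prop

theorem hasCompactSupport_laplacian_farKernel (hn : 2 ≤ n) {c : ℝ} (hc : 0 < c) :
    HasCompactSupport (laplacian (farKernel n c)) := by
  refine HasCompactSupport.intro (isCompact_closedBall 0 c⁻¹) fun z hz => ?_
  rw [mem_closedBall_zero_iff, not_le] at hz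
  exact laplacian_farKernel_eq_zero hn hc hz

end Kernel

/-! ### Bounds for the kernels and the total Laplacian of the far part -/

section Bounds

variable {n : ℕ}

theorem nontrivial_eucl (hn : 1 ≤ n) : Nontrivial (Eucl n) := by
  have : Nonempty (Fin n) := ⟨⟨0, hn⟩⟩
  infer_instance

/-- A continuous function which is `O(|z|^{-m})` at infinity is bounded by a multiple of
`(1 + |z|)^{-m}`. -/
theorem exists_bound_one_add_norm {F : Type*} [NormedAddCommGroup F] {g : Eucl n → F}
    (hg : Continuous g) (m : ℕ) {R C : ℝ} (hR : 1 ≤ R) (hC : 0 ≤ C)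
    (h : ∀ z, R < ‖z‖ → ‖g z‖ ≤ C * (‖z‖ ^ m)⁻¹) :
    ∃ C' : ℝ, 0 ≤ C' ∧ ∀ z, ‖g z‖ ≤ C' * ((1 + ‖z‖) ^ m)⁻¹ := by
  obtain ⟨B, hB⟩ := (isCompact_closedBall (0 : Eucl n) R).exists_bound_of_continuousOn
    hg.continuousOn
  have hB0 : 0 ≤ B := (norm_nonneg _).trans (hB 0 (by simp; linarith))
  refine ⟨B * (1 + R) ^ m + C * 2 ^ m, by positivity, fun z => ?_⟩
  have hz := norm_nonneg z
  rw [add_mul]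
  rcases le_or_gt ‖z‖ R with hzR | hzR
  · have h1 : (1 + ‖z‖) ^ m ≤ (1 + R) ^ m := by gcongr
    calc ‖g z‖ ≤ B := hB z (by simpa using hzR)
      _ = B * (1 + ‖z‖) ^ m * ((1 + ‖z‖) ^ m)⁻¹ := by field_simp
      _ ≤ B * (1 + R) ^ m * ((1 + ‖z‖) ^ m)⁻¹ := by gcongr
      _ ≤ _ := le_add_of_nonneg_right (by positivity)
  · have hz1 : 1 ≤ ‖z‖ := hR.trans hzR.le
    have h1 : (1 + ‖z‖) ^ m ≤ 2 ^ m * ‖z‖ ^ m := by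
      rw [← mul_pow]; gcongr; linarith
    calc ‖g z‖ ≤ C * (‖z‖ ^ m)⁻¹ := h z hzR
      _ ≤ C * (2 ^ m * ((1 + ‖z‖) ^ m)⁻¹) := by
        gcongr
        rw [inv_le_iff_one_le_mul₀ (by positivity), mul_right_comm, ← div_eq_mul_inv,
          one_le_div (by positivity)]
        exact h1
      _ = C * 2 ^ m * ((1 + ‖z‖) ^ m)⁻¹ := by ring
      _ ≤ _ := le_add_of_nonneg_left (by positivity)

theorem norm_newtonKernel (z : Eucl n) : ‖newtonKernel n z‖ = (‖z‖ ^ (n - 2))⁻¹ := by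
  rw [newtonKernel, norm_div, norm_pow, norm_norm]
  simp

theorem norm_fderiv_newtonKernel (hn : 2 ≤ n) {z : Eucl n} (hz : z ≠ 0) :
    ‖fderiv ℝ (newtonKernel n) z‖ = ((n : ℝ) - 2) * (‖z‖ ^ (n - 1))⁻¹ := by
  have hn' : (2 : ℝ) ≤ n := by exact_mod_cast hn
  have hz0 : ‖z‖ ≠ 0 := norm_ne_zero_iff.2 hz
  have e : ‖z‖ ^ n = ‖z‖ ^ (n - 1) * ‖z‖ := by rw [← pow_succ]; congr 1; omega
  rw [fderiv_newtonKernel hn hz, norm_smul, innerSL_apply_norm, norm_mul, norm_neg,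
    Real.norm_of_nonneg (by linarith), norm_inv, norm_pow, norm_norm, e]
  field_simp

theorem norm_fderiv_fderiv_newtonKernel_le (hn : 2 ≤ n) {z : Eucl n} (hz : z ≠ 0) (w : Eucl n) :
    ‖fderiv ℝ (fun y => fderiv ℝ (newtonKernel n) y w) z‖ ≤
      (((n : ℝ) - 2) * (1 + n) * ‖w‖) * (‖z‖ ^ n)⁻¹ := by
  have hn' : (2 : ℝ) ≤ n := by exact_mod_cast hn
  have hn2 : (0 : ℝ) ≤ n - 2 := by linarith
  have hz0 : ‖z‖ ≠ 0 := norm_ne_zero_iff.2 hz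
  refine ContinuousLinearMap.opNorm_le_bound _ (by positivity) fun v => ?_
  rw [fderiv_fderiv_newtonKernel hn hz, norm_mul, norm_neg, Real.norm_of_nonneg hn2]
  have h1 : ‖(‖z‖ ^ n)⁻¹ * inner ℝ v w‖ ≤ (‖z‖ ^ n)⁻¹ * (‖v‖ * ‖w‖) := by
    rw [norm_mul, norm_inv, norm_pow, norm_norm]
    gcongr
    exact norm_inner_le_norm v w
  have h2 : ‖n * (‖z‖ ^ (n + 2))⁻¹ * inner ℝ z v * inner ℝ z w‖ ≤
      n * (‖z‖ ^ (n + 2))⁻¹ * (‖z‖ * ‖v‖) * (‖z‖ * ‖w‖) := by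
    rw [norm_mul, norm_mul, norm_mul, norm_inv, norm_pow, norm_norm,
      Real.norm_of_nonneg (Nat.cast_nonneg n)]
    gcongr
    · exact norm_inner_le_norm z v
    · exact norm_inner_le_norm z w
  have h3 : n * (‖z‖ ^ (n + 2))⁻¹ * (‖z‖ * ‖v‖) * (‖z‖ * ‖w‖) =
      n * (‖z‖ ^ n)⁻¹ * (‖v‖ * ‖w‖) := by
    rw [pow_add]; field_simp
  calc ((n : ℝ) - 2) * _ ≤ ((n : ℝ) - 2) *
        ((‖z‖ ^ n)⁻¹ * (‖v‖ * ‖w‖) + n * (‖z‖ ^ n)⁻¹ * (‖v‖ * ‖w‖)) := by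
        gcongr
        exact (norm_sub_le _ _).trans (add_le_add h1 (h2.trans_eq h3))
    _ = _ := by ring

theorem pow_inv_le_pow_inv_of_one_le {r : ℝ} (hr : 1 ≤ r) {a b : ℕ} (h : a ≤ b) :
    (r ^ b)⁻¹ ≤ (r ^ a)⁻¹ := by
  gcongr

theorem exists_bound_farKernel {c : ℝ} (hc : 0 < c) :
    ∃ C : ℝ, 0 ≤ C ∧ ∀ z : Eucl n, ‖farKernel n c z‖ ≤ C * ((1 + ‖z‖) ^ (n - 2))⁻¹ := by
  refine exists_bound_one_add_norm (contDiff_farKernel hc 0).continuous _ (R := 1 + c⁻¹)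
    (C := 1) (by simp [hc.le]) zero_le_one fun z hz => ?_
  have hz' : c⁻¹ < ‖z‖ := by linarith
  rw [(farKernel_eventuallyEq hc hz').eq_of_nhds, norm_newtonKernel, one_mul]

theorem exists_bound_fderiv_farKernel (hn : 2 ≤ n) {c : ℝ} (hc : 0 < c) :
    ∃ C : ℝ, 0 ≤ C ∧ ∀ z : Eucl n, ‖fderiv ℝ (farKernel n c) z‖ ≤ C * ((1 + ‖z‖) ^ (n - 1))⁻¹ := by
  have hn' : (2 : ℝ) ≤ n := by exact_mod_cast hn
  have hn2 : (0 : ℝ) ≤ n - 2 := by linarith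
  refine exists_bound_one_add_norm ((contDiff_farKernel hc 1).continuous_fderiv one_ne_zero) _
    (R := 1 + c⁻¹) (C := (n : ℝ) - 2) (by simp [hc.le]) hn2 fun z hz => ?_
  have hci : 0 < c⁻¹ := inv_pos.2 hc
  have hz' : c⁻¹ < ‖z‖ := by linarith
  rw [(farKernel_eventuallyEq hc hz').fderiv_eq,
    norm_fderiv_newtonKernel hn (norm_pos_iff.1 (hci.trans hz'))]

theorem exists_bound_fderiv_fderiv_farKernel (hn : 2 ≤ n) {c : ℝ} (hc : 0 < c) (w : Eucl n) :
    ∃ C : ℝ, 0 ≤ C ∧ ∀ z : Eucl n, ‖fderiv ℝ (fun y => fderiv ℝ (farKernel n c) y w) z‖ ≤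
      C * ((1 + ‖z‖) ^ n)⁻¹ := by
  have hn' : (2 : ℝ) ≤ n := by exact_mod_cast hn
  have hn2 : (0 : ℝ) ≤ n - 2 := by linarith
  refine exists_bound_one_add_norm
    ((contDiff_fderiv_farKernel hc 1 w).continuous_fderiv one_ne_zero) _
    (R := 1 + c⁻¹) (C := ((n : ℝ) - 2) * (1 + n) * ‖w‖) (by simp [hc.le])
    (by positivity) fun z hz => ?_
  have hci : 0 < c⁻¹ := inv_pos.2 hc
  have hz' : c⁻¹ < ‖z‖ := by linarith
  have : (fun y => fderiv ℝ (farKernel n c) y w) =ᶠ[𝓝 z]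
      fun y => fderiv ℝ (newtonKernel n) y w := by
    filter_upwards [(farKernel_eventuallyEq hc hz').fderiv (𝕜 := ℝ)] with y hy
    rw [hy]
  rw [this.fderiv_eq]
  exact norm_fderiv_fderiv_newtonKernel_le hn (norm_pos_iff.1 (hci.trans hz')) w

theorem integrableOn_norm_pow_inv (hn : 1 ≤ n) {m : ℕ} (hm : m + 1 ≤ n) (r : ℝ) :
    IntegrableOn (fun z : Eucl n => (‖z‖ ^ m)⁻¹) (Metric.ball 0 r) := by
  have := nontrivial_eucl hn
  rw [integrableOn_fun_norm_addHaar (volume : Measure (Eucl n)) (f := fun t => (t ^ m)⁻¹)]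
  simp only [finrank_euclideanSpace, Fintype.card_fin, smul_eq_mul]
  have h1 : IntegrableOn (fun y : ℝ => y ^ (n - 1 - m)) (Set.Ioo 0 r) :=
    ((continuous_pow _).integrableOn_Icc (a := 0) (b := r)).mono_set Set.Ioo_subset_Icc_self
  refine h1.congr_fun (fun y hy => ?_) measurableSet_Ioo
  have hy0 : y ≠ 0 := hy.1.ne'
  have : n - 1 = (n - 1 - m) + m := by omega
  simp only
  rw [this, pow_add, Nat.add_sub_cancel]
  field_simp

theorem locallyIntegrable_of_norm_le_norm_pow_inv {F : Type*} [NormedAddCommGroup F]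
    (hn : 1 ≤ n) {m : ℕ} (hm : m + 1 ≤ n) {g : Eucl n → F} (hg : AEStronglyMeasurable g volume)
    {C : ℝ} (h : ∀ z, z ≠ 0 → ‖g z‖ ≤ C * (‖z‖ ^ m)⁻¹) : LocallyIntegrable g := by
  have := nontrivial_eucl hn
  rw [locallyIntegrable_iff]
  intro S hS
  obtain ⟨r, hr⟩ := hS.isBounded.subset_ball 0
  refine IntegrableOn.mono_set ?_ hr
  refine ((integrableOn_norm_pow_inv hn hm r).const_mul C).mono' hg.restrict ?_
  refine ae_restrict_of_ae ?_
  filter_upwards [Measure.ae_ne volume 0] with z hz using h z hz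

theorem measurable_newtonKernel : Measurable (newtonKernel n) := by
  unfold newtonKernel; fun_prop

theorem measurable_nearKernel (c : ℝ) : Measurable (nearKernel n c) := by
  unfold nearKernel
  exact ((contDiff_cutoff 0).continuous.comp (continuous_const_smul (2 * c))).measurable.mul
    measurable_newtonKernel

theorem locallyIntegrable_newtonKernel (hn : 2 ≤ n) : LocallyIntegrable (newtonKernel n) :=
  locallyIntegrable_of_norm_le_norm_pow_inv (by omega) (m := n - 2) (by omega)
    measurable_newtonKernel.aestronglyMeasurable (C := 1)
    fun z _ => by rw [norm_newtonKernel, one_mul]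

theorem locallyIntegrable_fderiv_newtonKernel (hn : 2 ≤ n) :
    LocallyIntegrable (fderiv ℝ (newtonKernel n)) :=
  locallyIntegrable_of_norm_le_norm_pow_inv (by omega) (m := n - 1) (by omega)
    (measurable_fderiv ℝ _).aestronglyMeasurable
    fun _ hz => (norm_fderiv_newtonKernel hn hz).le

theorem integrable_of_bounded_support {F : Type*} [NormedAddCommGroup F] {g : Eucl n → F} {r : ℝ}
    (hg : LocallyIntegrable g) (h : ∀ z, r < ‖z‖ → g z = 0) : Integrable g := by
  refine (hg.integrableOn_isCompact (isCompact_closedBall 0 r)).integrable_of_forall_notMem_eq_zero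
    fun z hz => h z ?_
  simpa using hz

theorem integrable_nearKernel (hn : 2 ≤ n) {c : ℝ} (hc : 0 < c) : Integrable (nearKernel n c) := by
  refine integrable_of_bounded_support (r := c⁻¹) ?_ fun z hz => nearKernel_eq_zero hc hz.le
  have h := (locallyIntegrable_newtonKernel hn).sub
    ((contDiff_farKernel hc 0).continuous.locallyIntegrable (μ := (volume : Measure (Eucl n))))
  convert h using 1
  funext z
  simp [farKernel]

theorem fderiv_nearKernel (c : ℝ) (hc : 0 < c) {z : Eucl n} (hz : z ≠ 0) :
    fderiv ℝ (nearKernel n c) z = fderiv ℝ (newtonKernel n) z - fderiv ℝ (farKernel n c) z := by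
  have e : nearKernel n c = newtonKernel n - farKernel n c := by
    funext y; simp [farKernel]
  rw [e, fderiv_sub ((contDiffAt_newtonKernel hz 1).differentiableAt one_ne_zero)
    ((contDiff_farKernel hc 1).differentiable one_ne_zero z)]

theorem integrable_fderiv_nearKernel (hn : 2 ≤ n) {c : ℝ} (hc : 0 < c) :
    Integrable (fderiv ℝ (nearKernel n c)) := by
  have := nontrivial_eucl (n := n) (by omega)
  refine integrable_of_bounded_support (r := c⁻¹) ?_ fun z hz => fderiv_nearKernel_eq_zero hc hz
  have h := (locallyIntegrable_fderiv_newtonKernel hn).sub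
    (((contDiff_farKernel hc 1).continuous_fderiv one_ne_zero).locallyIntegrable
      (μ := (volume : Measure (Eucl n))))
  refine h.congr ?_
  filter_upwards [Measure.ae_ne volume 0] with z hz
  rw [fderiv_nearKernel c hc hz]
  rfl

/-- The gradients of the near kernels tend to `0` in mean. -/
theorem integral_norm_fderiv_nearKernel (hn : 2 ≤ n) {c : ℝ} (hc : 0 < c) :
    ∫ z, ‖fderiv ℝ (nearKernel n c) z‖ = c⁻¹ * ∫ z, ‖fderiv ℝ (nearKernel n 1) z‖ := by
  have e : ∀ z, ‖fderiv ℝ (nearKernel n c) z‖ =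
      (c ^ (n - 2) * c) * ‖fderiv ℝ (nearKernel n 1) (c • z)‖ := fun z => by
    rw [fderiv_nearKernel_smul hc, norm_smul, Real.norm_of_nonneg (by positivity)]
  simp_rw [e]
  rw [integral_const_mul, Measure.integral_comp_smul volume
    (fun z => ‖fderiv ℝ (nearKernel n 1) z‖) c, finrank_euclideanSpace, Fintype.card_fin,
    abs_of_pos (by positivity), smul_eq_mul, ← mul_assoc]
  congr 1
  have : c ^ n = c ^ (n - 2) * c * c := by
    rw [mul_assoc, ← pow_two, ← pow_add, Nat.sub_add_cancel hn]
  rw [this]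
  field_simp

theorem integral_norm_nearKernel (hn : 2 ≤ n) {c : ℝ} (hc : 0 < c) :
    ∫ z, ‖nearKernel n c z‖ = (c ^ 2)⁻¹ * ∫ z, ‖nearKernel n 1 z‖ := by
  have e : ∀ z, ‖nearKernel n c z‖ = c ^ (n - 2) * ‖nearKernel n 1 (c • z)‖ := fun z => by
    rw [nearKernel_smul hc, norm_mul, Real.norm_of_nonneg (by positivity)]
  simp_rw [e]
  rw [integral_const_mul, Measure.integral_comp_smul volume
    (fun z => ‖nearKernel n 1 z‖) c, finrank_euclideanSpace, Fintype.card_fin,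
    abs_of_pos (by positivity), smul_eq_mul, ← mul_assoc]
  congr 1
  have : c ^ n = c ^ (n - 2) * c ^ 2 := by rw [← pow_add, Nat.sub_add_cancel hn]
  rw [this]
  field_simp

/-- The total mass of the Laplacian of the regularized kernel does not depend on the scale. -/
theorem integral_laplacian_farKernel_scale (hn : 2 ≤ n) {c : ℝ} (hc : 0 < c) :
    ∫ z, laplacian (farKernel n c) z = ∫ z, laplacian (farKernel n 1) z := by
  simp_rw [laplacian_farKernel_smul hn hc]
  rw [integral_const_mul, Measure.integral_comp_smul volume (laplacian (farKernel n 1)) c,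
    finrank_euclideanSpace, Fintype.card_fin, abs_of_pos (by positivity), smul_eq_mul, ← mul_assoc]
  field_simp

theorem deriv_smoothTransition_eq_zero {t : ℝ} (ht : t < 0 ∨ 1 < t) :
    deriv Real.smoothTransition t = 0 := by
  rcases ht with ht | ht
  · have : Real.smoothTransition =ᶠ[𝓝 t] fun _ => 0 := by
      filter_upwards [Iio_mem_nhds ht] with s hs
      exact Real.smoothTransition.zero_of_nonpos (le_of_lt hs)
    rw [this.deriv_eq, deriv_const]
  · have : Real.smoothTransition =ᶠ[𝓝 t] fun _ => 1 := by
      filter_upwards [Ioi_mem_nhds ht] with s hs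
      exact Real.smoothTransition.one_of_one_le (le_of_lt hs)
    rw [this.deriv_eq, deriv_const]

theorem differentiable_smoothTransition : Differentiable ℝ Real.smoothTransition :=
  (Real.smoothTransition.contDiff (n := 1)).differentiable one_ne_zero

theorem fderiv_cutoff_apply (z v : Eucl n) :
    fderiv ℝ cutoff z v = -2 * deriv Real.smoothTransition (2 - ‖z‖ ^ 2) * inner ℝ z v := by
  have h1 : HasFDerivAt (fun y : Eucl n => 2 - ‖y‖ ^ 2) (-(2 • innerSL ℝ z)) z :=
    (hasStrictFDerivAt_norm_sq z).hasFDerivAt.const_sub 2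
  have h2 := (differentiable_smoothTransition (2 - ‖z‖ ^ 2)).hasDerivAt.comp_hasFDerivAt z h1
  refine (congrArg (fun T : Eucl n →L[ℝ] ℝ => T v) h2.fderiv).trans ?_
  simp
  ring

theorem integral_radial_deriv_smoothTransition :
    ∫ y in Set.Ioi (0 : ℝ), 2 * y * deriv Real.smoothTransition (2 - y ^ 2) = 1 := by
  have hd : Continuous (deriv Real.smoothTransition) :=
    (Real.smoothTransition.contDiff (n := 1)).continuous_deriv le_rfl
  have hF : ∀ y : ℝ, HasDerivAt (fun y : ℝ => -Real.smoothTransition (2 - y ^ 2))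
      (2 * y * deriv Real.smoothTransition (2 - y ^ 2)) y := fun y => by
    have h1 : HasDerivAt (fun y : ℝ => 2 - y ^ 2) (-(2 * y)) y := by
      simpa using (hasDerivAt_pow 2 y).const_sub 2
    refine (((differentiable_smoothTransition (2 - y ^ 2)).hasDerivAt.comp y h1).neg).congr_deriv ?_
    ring
  have hint : Integrable (fun y : ℝ => 2 * y * deriv Real.smoothTransition (2 - y ^ 2)) := by
    refine Continuous.integrable_of_hasCompactSupport (by fun_prop) ?_
    refine HasCompactSupport.intro (isCompact_closedBall 0 2) fun y hy => ?_
    rw [mem_closedBall_zero_iff, not_le, Real.norm_eq_abs] at hy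
    rw [deriv_smoothTransition_eq_zero (Or.inl ?_), mul_zero]
    nlinarith [sq_abs y]
  have hlim : Tendsto (fun y : ℝ => -Real.smoothTransition (2 - y ^ 2)) atTop (𝓝 0) := by
    refine tendsto_const_nhds.congr' ?_
    filter_upwards [eventually_ge_atTop 2] with y hy
    rw [Real.smoothTransition.zero_of_nonpos (by nlinarith), neg_zero]
  rw [integral_Ioi_of_hasDerivAt_of_tendsto (hF 0).continuousAt.continuousWithinAt
    (fun y _ => hF y) hint.integrableOn hlim, Real.smoothTransition.one_of_one_le (by norm_num)]
  norm_num

/-- The flux of the gradient of the Newtonian kernel. It is computed by testing the Laplacian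
of a regularized kernel with a cutoff that is `1` on its support, which moves the derivative to
the cutoff, and then by integration in polar coordinates. -/
theorem integral_laplacian_farKernel (hn : 3 ≤ n) {c : ℝ} (hc : 0 < c) :
    ∫ z, laplacian (farKernel n c) z = -(((n : ℝ) - 2) * sphereArea n) := by
  have := nontrivial_eucl (n := n) (by omega)
  rw [integral_laplacian_farKernel_scale (by omega) hc,
    ← integral_laplacian_farKernel_scale (by omega) two_pos]
  -- At scale `2` the Laplacian vanishes for `|z| > 1/2`, hence wherever the cutoff is not `1`; and
  -- the derivative of the cutoff lives on `|z| ≥ 1`, where the kernel is the Newtonian one.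
  let f : ℝ → ℝ := fun r =>
    2 * ((n : ℝ) - 2) * deriv Real.smoothTransition (2 - r ^ 2) * (r ^ n)⁻¹ * r ^ 2
  have hcut : ContDiff ℝ 1 (cutoff (n := n)) := contDiff_cutoff 1
  have hcut' := hcut.continuous_fderiv one_ne_zero
  have hfar : ∀ h, ContDiff ℝ 1 (fun z => fderiv ℝ (farKernel n 2) z (stdFrame n h)) :=
    fun h => contDiff_fderiv_farKernel two_pos 1 _
  have hfar' : ∀ h, Continuous (fun z => fderiv ℝ (fun y => fderiv ℝ (farKernel n 2) y
      (stdFrame n h)) z (stdFrame n h)) := fun h => by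
    have := (hfar h).continuous_fderiv one_ne_zero
    fun_prop
  have hi1 : ∀ h, Integrable (fun z : Eucl n => cutoff z * fderiv ℝ (fun y =>
      fderiv ℝ (farKernel n 2) y (stdFrame n h)) z (stdFrame n h)) := fun h =>
    (hcut.continuous.mul (hfar' h)).integrable_of_hasCompactSupport
      hasCompactSupport_cutoff.mul_right
  have hcs : ∀ v, HasCompactSupport (fun z : Eucl n => fderiv ℝ cutoff z v) := fun v =>
    hasCompactSupport_cutoff.fderiv_apply (𝕜 := ℝ) v
  have hi2 : ∀ h, Integrable (fun z : Eucl n => fderiv ℝ cutoff z (stdFrame n h) *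
      fderiv ℝ (farKernel n 2) z (stdFrame n h)) := fun h =>
    Continuous.integrable_of_hasCompactSupport
      (by have := (hfar h).continuous; fun_prop) (hcs _).mul_right
  have hi3 : ∀ h, Integrable (fun z : Eucl n => cutoff z *
      fderiv ℝ (farKernel n 2) z (stdFrame n h)) := fun h =>
    (hcut.continuous.mul (hfar h).continuous).integrable_of_hasCompactSupport
      hasCompactSupport_cutoff.mul_right
  have e1 : ∀ z, laplacian (farKernel n 2) z = ∑ h, cutoff z * fderiv ℝ (fun y =>
      fderiv ℝ (farKernel n 2) y (stdFrame n h)) z (stdFrame n h) := fun z => by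
    rw [← Finset.mul_sum]
    change _ = cutoff z * laplacian (farKernel n 2) z
    rcases le_or_gt ‖z‖ 1 with hz | hz
    · rw [cutoff_eq_one hz, one_mul]
    · rw [laplacian_farKernel_eq_zero (by omega) two_pos (by linarith), mul_zero]
  have e2 : ∀ z : Eucl n, ∑ h, fderiv ℝ cutoff z (stdFrame n h) *
      fderiv ℝ (farKernel n 2) z (stdFrame n h) = f ‖z‖ := fun z => by
    simp only [fderiv_cutoff_apply, f]
    rcases lt_or_ge ‖z‖ 1 with hz | hz
    · rw [deriv_smoothTransition_eq_zero (Or.inr (by nlinarith [norm_nonneg z]))]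
      simp
    · have hz0 : z ≠ 0 := norm_pos_iff.1 (by linarith)
      rw [(farKernel_eventuallyEq two_pos (by linarith)).fderiv_eq,
        fderiv_newtonKernel (by omega) hz0]
      rw [← sum_inner_stdFrame_mul_self z, Finset.mul_sum]
      refine Finset.sum_congr rfl fun h _ => ?_
      simp
      ring
  simp_rw [e1]
  rw [integral_finsetSum _ fun h _ => hi1 h]
  have e3 : ∀ h, ∫ z : Eucl n, cutoff z * fderiv ℝ (fun y =>
      fderiv ℝ (farKernel n 2) y (stdFrame n h)) z (stdFrame n h) =
      -∫ z : Eucl n, fderiv ℝ cutoff z (stdFrame n h) *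
        fderiv ℝ (farKernel n 2) z (stdFrame n h) := fun h =>
    integral_mul_fderiv_eq_neg_fderiv_mul_of_integrable (hi2 h) (hi1 h) (hi3 h)
      (fun z _ => hcut.differentiable one_ne_zero z)
      (fun z _ => (hfar h).differentiable one_ne_zero z)
  simp_rw [e3]
  rw [Finset.sum_neg_distrib, ← integral_finsetSum _ fun h _ => hi2 h]
  simp_rw [e2]
  rw [integral_fun_norm_addHaar volume f, sphereArea, Measure.toSphere_real_apply_univ,
    finrank_euclideanSpace, Fintype.card_fin]
  have e4 : ∫ y in Set.Ioi (0 : ℝ), y ^ (n - 1) • f y = (n : ℝ) - 2 := by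
    rw [← mul_one ((n : ℝ) - 2), ← integral_radial_deriv_smoothTransition, ← integral_const_mul]
    refine setIntegral_congr_fun measurableSet_Ioi fun y hy => ?_
    have hy0 : y ≠ 0 := ne_of_gt hy
    have : y ^ n = y ^ (n - 1) * y := by rw [← pow_succ]; congr 1; omega
    simp only [f, this, smul_eq_mul]
    field_simp
  rw [e4]
  simp only [nsmul_eq_mul, smul_eq_mul]
  ring

end Bounds

/-! ### Derivatives of convolutions with the near and the far kernel -/

section Conv

variable {n : ℕ} {F : Type*} [NormedAddCommGroup F] [NormedSpace ℝ F]
  {κ : Eucl n → ℝ} {γ : Eucl n → F}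

/-- The convolution `∫ κ(x - y) γ(y) dy` of a scalar kernel with a vector-valued function. -/
def conv (κ : Eucl n → ℝ) (γ : Eucl n → F) (x : Eucl n) : F := ∫ y, κ (x - y) • γ y

theorem conv_eq_convolution (κ : Eucl n → ℝ) (γ : Eucl n → F) :
    conv κ γ = κ ⋆[lsmul ℝ ℝ, volume] γ := by
  funext x
  rw [convolution_eq_swap]
  rfl

theorem conv_eq_convolution_flip (κ : Eucl n → ℝ) (γ : Eucl n → F) :
    conv κ γ = γ ⋆[(lsmul ℝ ℝ).flip, volume] κ := rfl

theorem conv_apply' (κ : Eucl n → ℝ) (γ : Eucl n → F) (x : Eucl n) :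
    conv κ γ x = ∫ t, κ t • γ (x - t) := by
  rw [conv_eq_convolution]; rfl

theorem integrable_conv_right (hκ : AEStronglyMeasurable κ volume) (hγ : Continuous γ)
    (h : ConvDominated volume κ γ) (x : Eucl n) : Integrable fun t => κ t • γ (x - t) :=
  h.convolutionExistsAt (lsmul ℝ ℝ) hκ hγ x

theorem integrable_conv_left (hγ : AEStronglyMeasurable γ volume) (hκ : Continuous κ)
    (h : ConvDominated volume γ κ) (x : Eucl n) : Integrable fun y => κ (x - y) • γ y :=
  h.convolutionExistsAt (lsmul ℝ ℝ).flip hγ hκ x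

theorem integrable_conv_swap {x : Eucl n} :
    (Integrable fun y => κ (x - y) • γ y) ↔ Integrable fun t => κ t • γ (x - t) := by
  rw [← integrable_comp_sub_left (fun t => κ t • γ (x - t)) x]
  simp

theorem continuous_conv_right (hκ : AEStronglyMeasurable κ volume) (hγ : Continuous γ)
    (h : ConvDominated volume κ γ) : Continuous (conv κ γ) := by
  rw [conv_eq_convolution]
  exact h.continuous_convolution _ hκ hγ

theorem continuous_conv_left (hγ : AEStronglyMeasurable γ volume) (hκ : Continuous κ)
    (h : ConvDominated volume γ κ) : Continuous (conv κ γ) := by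
  rw [conv_eq_convolution_flip]
  exact h.continuous_convolution _ hγ hκ

omit [NormedSpace ℝ F] in
/-- A bound for the convolution with a kernel of bounded support. -/
theorem norm_integral_kernel_le {W G : Type*} [NormedAddCommGroup W] [NormedAddCommGroup G]
    [NormedSpace ℝ G] {k : Eucl n → W} (hk : Integrable k) {r : ℝ}
    (hr : ∀ t, r < ‖t‖ → k t = 0) {x : Eucl n} {B : ℝ}
    (hB : ∀ t, ‖t‖ ≤ r → ‖γ (x - t)‖ ≤ B) {I : Eucl n → G}
    (hI : ∀ t, ‖I t‖ ≤ ‖k t‖ * ‖γ (x - t)‖) : ‖∫ t, I t‖ ≤ B * ∫ t, ‖k t‖ := by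
  rw [← integral_const_mul]
  refine norm_integral_le_of_norm_le (hk.norm.const_mul B) (Eventually.of_forall fun t => ?_)
  refine (hI t).trans ?_
  rcases lt_or_ge r ‖t‖ with ht | ht
  · simp [hr t ht]
  · rw [mul_comm]
    gcongr
    exact hB t ht

omit [NormedSpace ℝ F] in
theorem convDominated_nearKernel (hn : 2 ≤ n) {c : ℝ} (hc : 0 < c) (hγ : Continuous γ) :
    ConvDominated volume (nearKernel n c) γ :=
  convDominated_of_bounded_support_left (integrable_nearKernel hn hc)
    (fun _ hz => nearKernel_eq_zero hc hz.le) hγ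

theorem integrable_fderiv_nearKernel_apply (hn : 2 ≤ n) {c : ℝ} (hc : 0 < c) (v : Eucl n) :
    Integrable (fun z => fderiv ℝ (nearKernel n c) z v) :=
  (ContinuousLinearMap.apply ℝ ℝ v).integrable_comp (integrable_fderiv_nearKernel hn hc)

omit [NormedSpace ℝ F] in
theorem convDominated_fderiv_nearKernel_apply (hn : 2 ≤ n) {c : ℝ} (hc : 0 < c)
    (hγ : Continuous γ) (v : Eucl n) :
    ConvDominated volume (fun z => fderiv ℝ (nearKernel n c) z v) γ :=
  convDominated_of_bounded_support_left (integrable_fderiv_nearKernel_apply hn hc v)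
    (fun _ hz => by rw [fderiv_nearKernel_eq_zero hc hz]; rfl) hγ

omit [NormedSpace ℝ F] in
theorem exists_bound_translates (hγ : Continuous γ) (R : ℝ) (r : ℝ) :
    ∃ B : ℝ, 0 ≤ B ∧ ∀ x ∈ Metric.ball (0 : Eucl n) R, ∀ t : Eucl n, ‖t‖ ≤ r →
      ‖γ (x - t)‖ ≤ B := by
  obtain ⟨B, hB⟩ := (isCompact_closedBall (0 : Eucl n) (R + r)).exists_bound_of_continuousOn
    hγ.continuousOn
  refine ⟨max B 0, le_max_right _ _, fun x hx t ht => (hB _ ?_).trans (le_max_left _ _)⟩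
  rw [mem_ball_zero_iff] at hx
  rw [mem_closedBall_zero_iff]
  exact (norm_sub_le _ _).trans (by linarith)

variable [CompleteSpace F]

theorem fderiv_conv_right (hκ : AEStronglyMeasurable κ volume) (hγ : ContDiff ℝ 1 γ)
    (h : ConvDominated volume κ γ) (h' : ConvDominated volume κ (fderiv ℝ γ)) (x v : Eucl n) :
    fderiv ℝ (conv κ γ) x v = conv κ (fun z => fderiv ℝ γ z v) x := by
  rw [conv_eq_convolution, conv_eq_convolution]
  exact h.fderiv_convolution_apply h' _ hκ hγ x v

omit [CompleteSpace F] in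
theorem differentiable_conv_left (hγ : AEStronglyMeasurable γ volume) (hκ : ContDiff ℝ 1 κ)
    (h : ConvDominated volume γ κ) (h' : ConvDominated volume γ (fderiv ℝ κ)) :
    Differentiable ℝ (conv κ γ) := by
  rw [conv_eq_convolution_flip]
  exact h.differentiable_convolution h' _ hγ hκ

theorem fderiv_conv_left (hγ : AEStronglyMeasurable γ volume) (hκ : ContDiff ℝ 1 κ)
    (h : ConvDominated volume γ κ) (h' : ConvDominated volume γ (fderiv ℝ κ)) (x v : Eucl n) :
    fderiv ℝ (conv κ γ) x v = conv (fun z => fderiv ℝ κ z v) γ x := by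
  rw [conv_eq_convolution_flip, conv_eq_convolution_flip]
  exact h.fderiv_convolution_apply h' _ hγ hκ x v

omit [CompleteSpace F] in
theorem hasFDerivAt_conv_left (hγ : AEStronglyMeasurable γ volume) (hκ : ContDiff ℝ 1 κ)
    (h : ConvDominated volume γ κ) (h' : ConvDominated volume γ (fderiv ℝ κ)) (x : Eucl n) :
    HasFDerivAt (conv κ γ) (∫ t, (fderiv ℝ κ t).smulRight (γ (x - t))) x := by
  have e := h.hasFDerivAt_convolution h' (lsmul ℝ ℝ).flip hγ hκ x
  rw [convolution_eq_swap] at e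
  rw [conv_eq_convolution_flip]
  refine e.congr_fderiv (integral_congr_ae (Eventually.of_forall fun t => ?_))
  ext v
  rfl

omit [CompleteSpace F] in
/-- The convolution of the singular near kernel with a merely continuous function is
differentiable, with the derivative falling on the kernel. The kernel is the limit of the smooth
kernels `nearKernel n c - nearKernel n k`, `k → ∞`, whose gradients converge in mean, so that the
derivatives of the convolutions converge locally uniformly. -/
theorem hasFDerivAt_conv_nearKernel (hn : 2 ≤ n) {c : ℝ} (hc : 0 < c) (hγ : Continuous γ)
    (x : Eucl n) :
    HasFDerivAt (conv (nearKernel n c) γ)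
      (∫ t, (fderiv ℝ (nearKernel n c) t).smulRight (γ (x - t))) x := by
  have hnt := nontrivial_eucl (n := n) (by omega)
  let g : ℕ → Eucl n → ℝ := fun k => nearKernel n c - nearKernel n (k + 1)
  have hk : ∀ k : ℕ, (0 : ℝ) < (k : ℝ) + 1 := fun k => by positivity
  have hg_far : ∀ k, g k = farKernel n (k + 1) - farKernel n c := fun k => by
    funext z; simp [g, farKernel]
  have hg : ∀ k, ContDiff ℝ 1 (g k) := fun k => by
    rw [hg_far]; exact (contDiff_farKernel (hk k) 1).sub (contDiff_farKernel hc 1)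
  have hk1 : ∀ k : ℕ, ((k : ℝ) + 1)⁻¹ ≤ 1 := fun k =>
    inv_le_one_of_one_le₀ (by linarith [Nat.cast_nonneg (α := ℝ) k])
  have hgs : ∀ k, HasCompactSupport (g k) := fun k => by
    refine HasCompactSupport.intro (isCompact_closedBall 0 (c⁻¹ + 1)) fun z hz => ?_
    rw [mem_closedBall_zero_iff, not_le] at hz
    have := inv_pos.2 hc
    simp only [g, Pi.sub_apply]
    rw [nearKernel_eq_zero hc (by linarith), nearKernel_eq_zero (hk k) (by linarith [hk1 k]),
      sub_zero]
  have hγl := hγ.locallyIntegrable (μ := (volume : Measure (Eucl n)))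
  have hnear : ∀ c', 0 < c' → ∀ y, Integrable fun t => nearKernel n c' t • γ (y - t) :=
    fun c' hc' y => integrable_conv_right (measurable_nearKernel c').aestronglyMeasurable hγ
      (convDominated_nearKernel hn hc' hγ) y
  let Λ : (Eucl n →L[ℝ] ℝ) →L[ℝ] F →L[ℝ] Eucl n →L[ℝ] F := ContinuousLinearMap.smulRightL ℝ _ _
  have hnear' : ∀ c', 0 < c' → ∀ y,
      Integrable fun t => (fderiv ℝ (nearKernel n c') t).smulRight (γ (y - t)) :=
    fun c' hc' y => (convDominated_of_bounded_support_left (integrable_fderiv_nearKernel hn hc')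
      (fun _ hz => fderiv_nearKernel_eq_zero hc' hz) hγ).convolutionExistsAt Λ
      (integrable_fderiv_nearKernel hn hc').aestronglyMeasurable hγ y
  have hder : ∀ k y, HasFDerivAt (conv (g k) γ) (∫ t, (fderiv ℝ (g k) t).smulRight (γ (y - t))) y :=
    fun k y => hasFDerivAt_conv_left hγ.aestronglyMeasurable (hg k)
      (convDominated_of_hasCompactSupport_right hγl (hg k).continuous (hgs k))
      (convDominated_of_hasCompactSupport_right hγl ((hg k).continuous_fderiv one_ne_zero)
        ((hgs k).fderiv ℝ)) y
  -- The error terms are convolutions with the kernels concentrated in shrinking balls.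
  have hdiff : ∀ k y, conv (nearKernel n c) γ y - conv (g k) γ y =
      ∫ t, nearKernel n (k + 1) t • γ (y - t) := fun k y => by
    have e : ∀ t, g k t • γ (y - t) =
        nearKernel n c t • γ (y - t) - nearKernel n (k + 1) t • γ (y - t) := fun t => by
      simp only [g, Pi.sub_apply, sub_smul]
    rw [conv_apply', conv_apply']
    simp_rw [e]
    rw [integral_sub (hnear c hc y) (hnear _ (hk k) y)]
    abel
  have hdiff' : ∀ k y, (∫ t, (fderiv ℝ (nearKernel n c) t).smulRight (γ (y - t))) -
      (∫ t, (fderiv ℝ (g k) t).smulRight (γ (y - t))) =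
      ∫ t, (fderiv ℝ (nearKernel n (k + 1)) t).smulRight (γ (y - t)) := fun k y => by
    have e : (fun t => (fderiv ℝ (g k) t).smulRight (γ (y - t))) =ᵐ[volume] fun t =>
        (fderiv ℝ (nearKernel n c) t).smulRight (γ (y - t)) -
          (fderiv ℝ (nearKernel n (k + 1)) t).smulRight (γ (y - t)) := by
      filter_upwards [Measure.ae_ne volume 0] with t ht
      simp only [g]
      rw [fderiv_sub ((contDiffAt_nearKernel c ht 1).differentiableAt one_ne_zero)
        ((contDiffAt_nearKernel _ ht 1).differentiableAt one_ne_zero)]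
      ext v
      simp [sub_smul]
    rw [integral_congr_ae e, integral_sub (hnear' c hc y) (hnear' _ (hk k) y)]
    abel
  obtain ⟨B, hB0, hB⟩ := exists_bound_translates hγ (‖x‖ + 1) 1
  have hle : ∀ k : ℕ, ∀ y ∈ Metric.ball (0 : Eucl n) (‖x‖ + 1),
      ‖∫ t, nearKernel n (k + 1) t • γ (y - t)‖ ≤
        B * ((((k : ℝ) + 1) ^ 2)⁻¹ * ∫ z, ‖nearKernel n 1 z‖) := fun k y hy => by
    rw [← integral_norm_nearKernel hn (hk k)]
    exact norm_integral_kernel_le (integrable_nearKernel hn (hk k)) (r := 1)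
      (fun t ht => nearKernel_eq_zero (hk k) (by linarith [hk1 k])) (hB y hy)
      fun t => (norm_smul _ _).le
  have hle' : ∀ k : ℕ, ∀ y ∈ Metric.ball (0 : Eucl n) (‖x‖ + 1),
      ‖∫ t, (fderiv ℝ (nearKernel n (k + 1)) t).smulRight (γ (y - t))‖ ≤
        B * (((k : ℝ) + 1)⁻¹ * ∫ z, ‖fderiv ℝ (nearKernel n 1) z‖) := fun k y hy => by
    rw [← integral_norm_fderiv_nearKernel hn (hk k)]
    exact norm_integral_kernel_le (integrable_fderiv_nearKernel hn (hk k)) (r := 1)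
      (fun t ht => fderiv_nearKernel_eq_zero (hk k) (by linarith [hk1 k])) (hB y hy)
      fun t => (ContinuousLinearMap.norm_smulRight_apply _ _).le
  have hlim : Tendsto (fun k : ℕ => ((k : ℝ) + 1)⁻¹) atTop (𝓝 0) := by
    simpa [one_div] using tendsto_one_div_add_atTop_nhds_zero_nat (𝕜 := ℝ)
  refine hasFDerivAt_of_tendstoUniformlyOn (l := (atTop : Filter ℕ)) Metric.isOpen_ball
    (f := fun k => conv (g k) γ) (f' := fun k y => ∫ t, (fderiv ℝ (g k) t).smulRight (γ (y - t)))
    (g' := fun y => ∫ t, (fderiv ℝ (nearKernel n c) t).smulRight (γ (y - t)))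
    (s := Metric.ball 0 (‖x‖ + 1))
    ?_ (fun k y _ => hder k y) (fun y hy => ?_) (by simp)
  · rw [Metric.tendstoUniformlyOn_iff]
    intro ε hε
    have h0 : Tendsto (fun k : ℕ => B * (((k : ℝ) + 1)⁻¹ *
        ∫ z, ‖fderiv ℝ (nearKernel n 1) z‖)) atTop (𝓝 0) := by
      simpa using (hlim.mul_const (∫ z, ‖fderiv ℝ (nearKernel n 1) z‖)).const_mul B
    filter_upwards [h0.eventually_lt_const hε] with k hkε y hy
    rw [dist_eq_norm, hdiff' k y]
    exact (hle' k y hy).trans_lt hkε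
  · rw [tendsto_iff_norm_sub_tendsto_zero]
    have h0 : Tendsto (fun k : ℕ => B * ((((k : ℝ) + 1) ^ 2)⁻¹ *
        ∫ z, ‖nearKernel n 1 z‖)) atTop (𝓝 0) := by
      simpa using ((hlim.pow 2).mul_const (∫ z, ‖nearKernel n 1 z‖)).const_mul B
    refine squeeze_zero (fun _ => norm_nonneg _) (fun k => ?_) h0
    rw [norm_sub_rev, hdiff k y]
    exact hle k y hy

omit [CompleteSpace F] in
theorem fderiv_conv_nearKernel (hn : 2 ≤ n) {c : ℝ} (hc : 0 < c) (hγ : Continuous γ)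
    (x v : Eucl n) :
    fderiv ℝ (conv (nearKernel n c) γ) x v = conv (fun z => fderiv ℝ (nearKernel n c) z v) γ x := by
  rw [(hasFDerivAt_conv_nearKernel hn hc hγ x).fderiv, conv_apply',
    ContinuousLinearMap.integral_apply]
  · rfl
  · exact (convDominated_of_bounded_support_left (integrable_fderiv_nearKernel hn hc)
      (fun _ hz => fderiv_nearKernel_eq_zero hc hz) hγ).convolutionExistsAt
      (ContinuousLinearMap.smulRightL ℝ _ _)
      (integrable_fderiv_nearKernel hn hc).aestronglyMeasurable hγ x

omit [CompleteSpace F] in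
theorem differentiable_conv_nearKernel (hn : 2 ≤ n) {c : ℝ} (hc : 0 < c) (hγ : Continuous γ) :
    Differentiable ℝ (conv (nearKernel n c) γ) :=
  fun x => (hasFDerivAt_conv_nearKernel hn hc hγ x).differentiableAt

end Conv

/-! ### The Newtonian potential and Poisson's equation -/

section Potential

variable {n : ℕ} {F : Type*} [NormedAddCommGroup F] [NormedSpace ℝ F] {γ : Eucl n → F}

/-- Absolute convergence of the Newtonian potential of a vector-valued density at every point. -/
def NewtonConverges (γ : Eucl n → F) : Prop :=
  ∀ x : Eucl n, Integrable fun y : Eucl n => ‖γ y‖ / ‖x - y‖ ^ (n - 2)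

/-- The Newtonian potential `∫ γ(y) |x - y|^{-(n-2)} dy` of a vector-valued density. -/
def newtonPotential (γ : Eucl n → F) : Eucl n → F := conv (newtonKernel n) γ

theorem NewtonConverges.integrable (h : NewtonConverges γ)
    (hγ : AEStronglyMeasurable γ volume) (x : Eucl n) :
    Integrable fun y => newtonKernel n (x - y) • γ y := by
  refine (h x).mono' ((measurable_newtonKernel.comp (measurable_const.sub
    measurable_id)).aestronglyMeasurable.smul hγ) (Eventually.of_forall fun y => ?_)
  rw [norm_smul, norm_newtonKernel, mul_comm, ← div_eq_mul_inv]

omit [NormedSpace ℝ F] in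
theorem NewtonConverges.integrable_weight (hn : 1 ≤ n) (h : NewtonConverges γ)
    (hγ : AEStronglyMeasurable γ volume) (x : Eucl n) :
    Integrable fun y => ‖γ y‖ * ((1 + ‖x - y‖) ^ (n - 2))⁻¹ := by
  have := nontrivial_eucl hn
  refine (h x).mono' (hγ.norm.mul (Measurable.aestronglyMeasurable (by fun_prop))) ?_
  filter_upwards [Measure.ae_ne volume x] with y hy
  have h0 : 0 < ‖x - y‖ := norm_pos_iff.2 (sub_ne_zero.2 (Ne.symm hy))
  rw [norm_mul, norm_norm, norm_inv, norm_pow, Real.norm_of_nonneg (by positivity), div_eq_mul_inv]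
  gcongr
  linarith

omit [NormedSpace ℝ F] in
/-- A kernel which is `O((1 + |z|)^{-(n-2)})` has a dominated convolution with every density whose
Newtonian potential converges. -/
theorem NewtonConverges.convDominated (hn : 1 ≤ n) (h : NewtonConverges γ)
    (hγ : AEStronglyMeasurable γ volume) {W : Type*} [NormedAddCommGroup W] {κ : Eucl n → W} {C : ℝ}
    (hC : 0 ≤ C) (hκ : ∀ z, ‖κ z‖ ≤ C * ((1 + ‖z‖) ^ (n - 2))⁻¹) : ConvDominated volume γ κ := by
  intro x₀
  refine ⟨_, (h.integrable_weight hn hγ x₀).const_mul (C * 2 ^ (n - 2)), fun x hx t => ?_⟩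
  have h1 : 1 + ‖x₀ - t‖ ≤ 2 * (1 + ‖x - t‖) := by
    rw [Metric.mem_ball', dist_eq_norm] at hx
    have := norm_sub_le_norm_sub_add_norm_sub x₀ x t
    linarith [norm_nonneg (x - t)]
  have h2 : (1 + ‖x₀ - t‖) ^ (n - 2) ≤ 2 ^ (n - 2) * (1 + ‖x - t‖) ^ (n - 2) := by
    rw [← mul_pow]; gcongr
  have h3 : ((1 + ‖x - t‖) ^ (n - 2))⁻¹ ≤ 2 ^ (n - 2) * ((1 + ‖x₀ - t‖) ^ (n - 2))⁻¹ := by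
    rw [← div_eq_mul_inv, le_div_iff₀ (by positivity), inv_mul_le_iff₀ (by positivity), mul_comm]
    exact h2
  calc ‖γ t‖ * ‖κ (x - t)‖ ≤ ‖γ t‖ * (C * (2 ^ (n - 2) * ((1 + ‖x₀ - t‖) ^ (n - 2))⁻¹)) := by
        gcongr
        exact (hκ _).trans (by gcongr)
    _ = _ := by ring

theorem one_add_pow_inv_anti (z : Eucl n) {a b : ℕ} (h : a ≤ b) :
    ((1 + ‖z‖) ^ b)⁻¹ ≤ ((1 + ‖z‖) ^ a)⁻¹ :=
  pow_inv_le_pow_inv_of_one_le (by linarith [norm_nonneg z]) h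

omit [NormedSpace ℝ F] in
theorem NewtonConverges.convDominated_farKernel (hn : 1 ≤ n) (h : NewtonConverges γ)
    (hγ : AEStronglyMeasurable γ volume) {c : ℝ} (hc : 0 < c) :
    ConvDominated volume γ (farKernel n c) := by
  obtain ⟨C, hC, hle⟩ := exists_bound_farKernel (n := n) hc
  exact h.convDominated hn hγ hC hle

omit [NormedSpace ℝ F] in
theorem NewtonConverges.convDominated_fderiv_farKernel (hn : 2 ≤ n) (h : NewtonConverges γ)
    (hγ : AEStronglyMeasurable γ volume) {c : ℝ} (hc : 0 < c) :
    ConvDominated volume γ (fderiv ℝ (farKernel n c)) := by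
  obtain ⟨C, hC, hle⟩ := exists_bound_fderiv_farKernel hn hc
  refine h.convDominated (by omega) hγ hC fun z => (hle z).trans ?_
  exact mul_le_mul_of_nonneg_left (one_add_pow_inv_anti z (by omega)) hC

omit [NormedSpace ℝ F] in
theorem NewtonConverges.convDominated_fderiv_fderiv_farKernel (hn : 2 ≤ n)
    (h : NewtonConverges γ) (hγ : AEStronglyMeasurable γ volume) {c : ℝ} (hc : 0 < c) (w : Eucl n) :
    ConvDominated volume γ (fderiv ℝ fun y => fderiv ℝ (farKernel n c) y w) := by
  obtain ⟨C, hC, hle⟩ := exists_bound_fderiv_fderiv_farKernel hn hc w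
  refine h.convDominated (by omega) hγ hC fun z => (hle z).trans ?_
  exact mul_le_mul_of_nonneg_left (one_add_pow_inv_anti z (by omega)) hC

/-- The potential is split into a singular part with a kernel of compact support and a smooth part
with a kernel of the decay of the Newtonian one. -/
theorem newtonPotential_eq_add (hn : 2 ≤ n) (h : NewtonConverges γ) (hγ : Continuous γ) {c : ℝ}
    (hc : 0 < c) : newtonPotential γ = conv (nearKernel n c) γ + conv (farKernel n c) γ := by
  funext x
  rw [Pi.add_apply, conv, conv, ← integral_add]
  · refine integral_congr_ae (Eventually.of_forall fun y => ?_)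
    simp only [← add_smul, farKernel, add_sub_cancel]
  · exact integrable_conv_swap.2 (integrable_conv_right
      (measurable_nearKernel c).aestronglyMeasurable hγ (convDominated_nearKernel hn hc hγ) x)
  · exact integrable_conv_left hγ.aestronglyMeasurable (contDiff_farKernel hc 0).continuous
      (h.convDominated_farKernel (by omega) hγ.aestronglyMeasurable hc) x

theorem contDiff_succ_of_fderiv_apply {f : Eucl n → F} {m : ℕ} (hf : Differentiable ℝ f)
    (h : ∀ v, ContDiff ℝ m fun x => fderiv ℝ f x v) : ContDiff ℝ (m + 1) f :=
  contDiff_succ_iff_fderiv_apply.2 ⟨hf, fun h => by simp at h, h⟩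

variable [CompleteSpace F]

omit [CompleteSpace F] in
theorem contDiff_one_conv_nearKernel (hn : 2 ≤ n) {c : ℝ} (hc : 0 < c) (hγ : Continuous γ) :
    ContDiff ℝ 1 (conv (nearKernel n c) γ) := by
  refine contDiff_succ_of_fderiv_apply (m := 0) (differentiable_conv_nearKernel hn hc hγ)
    fun v => contDiff_zero.2 ?_
  simp_rw [fderiv_conv_nearKernel hn hc hγ]
  exact continuous_conv_right (integrable_fderiv_nearKernel_apply hn hc v).aestronglyMeasurable hγ
    (convDominated_fderiv_nearKernel_apply hn hc hγ v)

theorem contDiff_one_conv_left {κ : Eucl n → ℝ} (hγ : AEStronglyMeasurable γ volume)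
    (hκ : ContDiff ℝ 1 κ) (h : ConvDominated volume γ κ)
    (h' : ConvDominated volume γ (fderiv ℝ κ)) : ContDiff ℝ 1 (conv κ γ) := by
  refine contDiff_succ_of_fderiv_apply (m := 0) (differentiable_conv_left hγ hκ h h')
    fun v => contDiff_zero.2 ?_
  simp_rw [fderiv_conv_left hγ hκ h h']
  have := hκ.continuous_fderiv one_ne_zero
  exact continuous_conv_left hγ (by fun_prop) (h'.fderiv_apply v)

/-- The Newtonian potential of a continuous density is continuously differentiable. -/
theorem contDiff_one_newtonPotential (hn : 2 ≤ n) (h : NewtonConverges γ) (hγ : Continuous γ) :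
    ContDiff ℝ 1 (newtonPotential γ) := by
  rw [newtonPotential_eq_add hn h hγ one_pos]
  exact (contDiff_one_conv_nearKernel hn one_pos hγ).add
    (contDiff_one_conv_left hγ.aestronglyMeasurable (contDiff_farKernel one_pos 1)
      (h.convDominated_farKernel (by omega) hγ.aestronglyMeasurable one_pos)
      (h.convDominated_fderiv_farKernel hn hγ.aestronglyMeasurable one_pos))

theorem fderiv_newtonPotential_eq_add (hn : 2 ≤ n) (h : NewtonConverges γ) (hγ : Continuous γ)
    {c : ℝ} (hc : 0 < c) (x v : Eucl n) :
    fderiv ℝ (newtonPotential γ) x v = fderiv ℝ (conv (nearKernel n c) γ) x v +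
      conv (fun z => fderiv ℝ (farKernel n c) z v) γ x := by
  have h1 := h.convDominated_farKernel (by omega) hγ.aestronglyMeasurable hc
  have h2 := h.convDominated_fderiv_farKernel hn hγ.aestronglyMeasurable hc
  have h3 := contDiff_farKernel (n := n) hc 1
  rw [newtonPotential_eq_add hn h hγ hc,
    fderiv_add (differentiable_conv_nearKernel hn hc hγ x)
      (differentiable_conv_left hγ.aestronglyMeasurable h3 h1 h2 x),
    ← fderiv_conv_left hγ.aestronglyMeasurable h3 h1 h2]
  rfl

omit [CompleteSpace F] in
theorem integrable_fderiv_nearKernel_smul (hn : 2 ≤ n) (hγ : Continuous γ)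
    (x v : Eucl n) : Integrable fun y => fderiv ℝ (nearKernel n 1) (x - y) v • γ y :=
  integrable_conv_swap.2 (integrable_conv_right
    (integrable_fderiv_nearKernel_apply hn one_pos v).aestronglyMeasurable hγ
    (convDominated_fderiv_nearKernel_apply hn one_pos hγ v) x)

omit [CompleteSpace F] in
theorem NewtonConverges.integrable_fderiv_farKernel (hn : 2 ≤ n) (h : NewtonConverges γ)
    (hγ : Continuous γ) (x v : Eucl n) :
    Integrable fun y => fderiv ℝ (farKernel n 1) (x - y) v • γ y :=
  integrable_conv_left hγ.aestronglyMeasurable (contDiff_fderiv_farKernel one_pos 0 v).continuous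
    ((h.convDominated_fderiv_farKernel hn hγ.aestronglyMeasurable one_pos).fderiv_apply v) x

omit [CompleteSpace F] in
theorem fderiv_newtonKernel_ae (hn : 2 ≤ n) (γ : Eucl n → F) (x v : Eucl n) :
    (fun y => fderiv ℝ (newtonKernel n) (x - y) v • γ y) =ᵐ[volume] fun y =>
      fderiv ℝ (nearKernel n 1) (x - y) v • γ y + fderiv ℝ (farKernel n 1) (x - y) v • γ y := by
  have := nontrivial_eucl (n := n) (by omega)
  filter_upwards [Measure.ae_ne volume x] with y hy
  rw [fderiv_nearKernel 1 one_pos (sub_ne_zero.2 (Ne.symm hy)), ← add_smul]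
  simp

omit [CompleteSpace F] in
theorem NewtonConverges.integrable_fderiv (hn : 2 ≤ n) (h : NewtonConverges γ)
    (hγ : Continuous γ) (x v : Eucl n) :
    Integrable fun y => fderiv ℝ (newtonKernel n) (x - y) v • γ y :=
  ((integrable_fderiv_nearKernel_smul hn hγ x v).add
    (h.integrable_fderiv_farKernel hn hγ x v)).congr (fderiv_newtonKernel_ae hn γ x v).symm

/-- The Newtonian potential of a continuous density may be differentiated under the integral. -/
theorem fderiv_newtonPotential (hn : 2 ≤ n) (h : NewtonConverges γ) (hγ : Continuous γ)
    (x v : Eucl n) : fderiv ℝ (newtonPotential γ) x v =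
      conv (fun z => fderiv ℝ (newtonKernel n) z v) γ x := by
  rw [fderiv_newtonPotential_eq_add hn h hγ one_pos, fderiv_conv_nearKernel hn one_pos hγ,
    conv, conv, conv, ← integral_add (integrable_fderiv_nearKernel_smul hn hγ x v)
      (h.integrable_fderiv_farKernel hn hγ x v)]
  exact integral_congr_ae (fderiv_newtonKernel_ae hn γ x v).symm

theorem fderiv_conv_nearKernel_right (hn : 2 ≤ n) {c : ℝ} (hc : 0 < c) (hγ : ContDiff ℝ 1 γ)
    (x v : Eucl n) : fderiv ℝ (conv (nearKernel n c) γ) x v =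
      conv (nearKernel n c) (fun z => fderiv ℝ γ z v) x :=
  fderiv_conv_right (measurable_nearKernel c).aestronglyMeasurable hγ
    (convDominated_nearKernel hn hc hγ.continuous)
    (convDominated_nearKernel hn hc (hγ.continuous_fderiv one_ne_zero)) x v

omit [CompleteSpace F] in
theorem continuous_fderiv_apply_const (hγ : ContDiff ℝ 1 γ) (v : Eucl n) :
    Continuous fun z => fderiv ℝ γ z v :=
  (hγ.continuous_fderiv one_ne_zero).clm_apply continuous_const

/-- Differentiation of the potential, with the derivative falling on the density in the near part
and on the kernel in the far part; each of the two parts can be differentiated once more. -/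
theorem fderiv_newtonPotential_split (hn : 2 ≤ n) (h : NewtonConverges γ) (hγ : ContDiff ℝ 1 γ)
    {c : ℝ} (hc : 0 < c) (v : Eucl n) :
    (fun x => fderiv ℝ (newtonPotential γ) x v) = conv (nearKernel n c) (fun z => fderiv ℝ γ z v) +
      conv (fun z => fderiv ℝ (farKernel n c) z v) γ := by
  funext x
  rw [fderiv_newtonPotential_eq_add hn h hγ.continuous hc, fderiv_conv_nearKernel_right hn hc hγ]
  rfl

/-- The Newtonian potential of a continuously differentiable density is of class `C²`. -/
theorem contDiff_two_newtonPotential (hn : 2 ≤ n) (h : NewtonConverges γ) (hγ : ContDiff ℝ 1 γ) :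
    ContDiff ℝ 2 (newtonPotential γ) := by
  have hm := hγ.continuous.aestronglyMeasurable (μ := (volume : Measure (Eucl n)))
  refine contDiff_succ_of_fderiv_apply (m := 1)
    ((contDiff_one_newtonPotential hn h hγ.continuous).differentiable one_ne_zero) fun v => ?_
  rw [fderiv_newtonPotential_split hn h hγ one_pos]
  exact (contDiff_one_conv_nearKernel hn one_pos (continuous_fderiv_apply_const hγ v)).add
    (contDiff_one_conv_left hm (contDiff_fderiv_farKernel one_pos 1 v)
      ((h.convDominated_fderiv_farKernel hn hm one_pos).fderiv_apply v)
      (h.convDominated_fderiv_fderiv_farKernel hn hm one_pos v))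

/-- For every scale `c`, the Laplacian of the potential is the convolution of the density with the
Laplacian of the regularized kernel, up to a term controlled by the near kernel. -/
theorem laplacian_newtonPotential_split (hn : 2 ≤ n) (h : NewtonConverges γ)
    (hγ : ContDiff ℝ 1 γ) {c : ℝ} (hc : 0 < c) (x : Eucl n) :
    laplacian (newtonPotential γ) x =
      (∑ i, conv (fun z => fderiv ℝ (nearKernel n c) z (stdFrame n i))
        (fun z => fderiv ℝ γ z (stdFrame n i)) x) + conv (laplacian (farKernel n c)) γ x := by
  have hm := hγ.continuous.aestronglyMeasurable (μ := (volume : Measure (Eucl n)))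
  have hfar : ∀ v, ContDiff ℝ 1 fun z => fderiv ℝ (farKernel n c) z v :=
    fun v => contDiff_fderiv_farKernel hc 1 v
  have hd : ∀ v, ConvDominated volume γ fun z => fderiv ℝ (farKernel n c) z v :=
    fun v => (h.convDominated_fderiv_farKernel hn hm hc).fderiv_apply v
  have hd' := fun v => h.convDominated_fderiv_fderiv_farKernel hn hm hc v
  have e : conv (laplacian (farKernel n c)) γ x = ∑ i, conv (fun z => fderiv ℝ (fun y =>
      fderiv ℝ (farKernel n c) y (stdFrame n i)) z (stdFrame n i)) γ x := by
    simp only [conv, laplacian, Finset.sum_smul]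
    refine integral_finsetSum _ fun i _ => integrable_conv_left hm ?_ ((hd' _).fderiv_apply _) x
    exact continuous_fderiv_apply_const (hfar _) _
  rw [e, ← Finset.sum_add_distrib]
  refine Finset.sum_congr rfl fun i _ => ?_
  rw [fderiv_newtonPotential_split hn h hγ hc,
    fderiv_add (differentiable_conv_nearKernel hn hc (continuous_fderiv_apply_const hγ _) x)
      (differentiable_conv_left hm (hfar _) (hd _) (hd' _) x), add_apply,
    fderiv_conv_nearKernel hn hc (continuous_fderiv_apply_const hγ _),
    fderiv_conv_left hm (hfar _) (hd _) (hd' _)]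

/-- The Laplacians of the far kernels are an approximate identity of mass `-(n-2) S_{n-1}`. -/
theorem tendsto_conv_laplacian_farKernel (hn : 3 ≤ n) (hγ : Continuous γ) (x : Eucl n) :
    Tendsto (fun k : ℕ => conv (laplacian (farKernel n (k + 1))) γ x) atTop
      (𝓝 (-(((n : ℝ) - 2) * sphereArea n) • γ x)) := by
  have hk : ∀ k : ℕ, (0 : ℝ) < (k : ℝ) + 1 := fun k => by positivity
  have hk1 : ∀ k : ℕ, ((k : ℝ) + 1)⁻¹ ≤ 1 := fun k =>
    inv_le_one_of_one_le₀ (by linarith [Nat.cast_nonneg (α := ℝ) k])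
  have hΨ := continuous_laplacian_farKernel (n := n) one_pos
  have hΨs := hasCompactSupport_laplacian_farKernel (n := n) (by omega) one_pos
  -- All scales reduce to scale `1` by the substitution `t = u / (k + 1)`.
  have e : ∀ k : ℕ, conv (laplacian (farKernel n (k + 1))) γ x =
      ∫ u, laplacian (farKernel n 1) u • γ (x - ((k : ℝ) + 1)⁻¹ • u) := fun k => by
    have h1 := Measure.integral_comp_smul volume
      (fun u : Eucl n => laplacian (farKernel n 1) u • γ (x - ((k : ℝ) + 1)⁻¹ • u)) ((k : ℝ) + 1)
    rw [finrank_euclideanSpace, Fintype.card_fin,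
      abs_of_pos (inv_pos.2 (pow_pos (hk k) n)), eq_inv_smul_iff₀ (pow_pos (hk k) n).ne'] at h1
    rw [← h1, conv_apply', ← integral_smul]
    refine integral_congr_ae (Eventually.of_forall fun t => ?_)
    simp only
    rw [laplacian_farKernel_smul (by omega) (hk k), smul_smul, smul_smul,
      inv_mul_cancel₀ (hk k).ne', one_smul]
  simp_rw [e]
  rw [← integral_laplacian_farKernel hn one_pos, ← integral_smul_const]
  obtain ⟨B, hB0, hB⟩ := exists_bound_translates hγ (‖x‖ + 1) 1
  refine tendsto_integral_of_dominated_convergence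
    (fun u => ‖laplacian (farKernel n 1) u‖ * B) (fun k => ?_)
    ((hΨ.integrable_of_hasCompactSupport hΨs).norm.mul_const B) (fun k => ?_) ?_
  · exact Continuous.aestronglyMeasurable (by fun_prop)
  · refine Eventually.of_forall fun u => ?_
    rw [norm_smul]
    rcases le_or_gt ‖u‖ 1 with hu | hu
    · gcongr
      refine hB x (by simp) _ ?_
      rw [norm_smul, Real.norm_of_nonneg (inv_pos.2 (hk k)).le]
      exact mul_le_one₀ (hk1 k) (norm_nonneg u) hu
    · rw [laplacian_farKernel_eq_zero (by omega) one_pos (by simpa using hu)]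
      simp
  · refine Eventually.of_forall fun u => ?_
    have hlim : Tendsto (fun k : ℕ => ((k : ℝ) + 1)⁻¹) atTop (𝓝 0) := by
      simpa [one_div] using tendsto_one_div_add_atTop_nhds_zero_nat (𝕜 := ℝ)
    have h1 : Tendsto (fun k : ℕ => x - ((k : ℝ) + 1)⁻¹ • u) atTop (𝓝 x) := by
      simpa using (hlim.smul_const u).const_sub x
    exact ((hγ.tendsto x).comp h1).const_smul _

/-- Poisson's equation for the Newtonian potential of a continuously differentiable density. -/
theorem laplacian_newtonPotential (hn : 3 ≤ n) (h : NewtonConverges γ) (hγ : ContDiff ℝ 1 γ)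
    (x : Eucl n) :
    laplacian (newtonPotential γ) x = -(((n : ℝ) - 2) * sphereArea n) • γ x := by
  have hn2 : 2 ≤ n := by omega
  have hk : ∀ k : ℕ, (0 : ℝ) < (k : ℝ) + 1 := fun k => by positivity
  have hk1 : ∀ k : ℕ, ((k : ℝ) + 1)⁻¹ ≤ 1 := fun k =>
    inv_le_one_of_one_le₀ (by linarith [Nat.cast_nonneg (α := ℝ) k])
  have hlim : Tendsto (fun k : ℕ => ((k : ℝ) + 1)⁻¹) atTop (𝓝 0) := by
    simpa [one_div] using tendsto_one_div_add_atTop_nhds_zero_nat (𝕜 := ℝ)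
  have h0 : ∀ i, Tendsto (fun k : ℕ => conv (fun z => fderiv ℝ (nearKernel n (k + 1)) z
      (stdFrame n i)) (fun z => fderiv ℝ γ z (stdFrame n i)) x) atTop (𝓝 0) := fun i => by
    obtain ⟨B, hB0, hB⟩ := exists_bound_translates
      (continuous_fderiv_apply_const hγ (stdFrame n i)) (‖x‖ + 1) 1
    have h0 : Tendsto (fun k : ℕ => B * (((k : ℝ) + 1)⁻¹ *
        ∫ z, ‖fderiv ℝ (nearKernel n 1) z‖)) atTop (𝓝 0) := by
      simpa using (hlim.mul_const (∫ z, ‖fderiv ℝ (nearKernel n 1) z‖)).const_mul B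
    refine squeeze_zero_norm (fun k => ?_) h0
    rw [conv_apply', ← integral_norm_fderiv_nearKernel hn2 (hk k)]
    refine norm_integral_kernel_le (γ := fun z => fderiv ℝ γ z (stdFrame n i))
      (integrable_fderiv_nearKernel hn2 (hk k)) (r := 1)
      (fun t ht => fderiv_nearKernel_eq_zero (hk k) (by linarith [hk1 k])) (hB x (by simp))
      fun t => ?_
    rw [norm_smul]
    gcongr
    refine ((fderiv ℝ (nearKernel n (k + 1)) t).le_opNorm _).trans ?_
    rw [(stdFrame n).norm_eq_one, mul_one]
  have h1 := (tendsto_finsetSum Finset.univ fun i _ => h0 i).add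
    (tendsto_conv_laplacian_farKernel hn hγ.continuous x)
  simp_rw [← laplacian_newtonPotential_split hn2 h hγ (hk _)] at h1
  simpa using tendsto_nhds_unique tendsto_const_nhds h1

omit [NormedSpace ℝ F] [CompleteSpace F] in
theorem newtonConverges_of_hasCompactSupport (hn : 2 ≤ n) (hγ : Continuous γ)
    (hs : HasCompactSupport γ) : NewtonConverges γ := fun x => by
  have h := (integrable_conv_swap (κ := newtonKernel n) (γ := fun y => ‖γ y‖)).2
    (integrable_conv_right measurable_newtonKernel.aestronglyMeasurable hγ.norm
    (convDominated_of_hasCompactSupport_right (locallyIntegrable_newtonKernel hn) hγ.norm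
      hs.norm) x)
  refine h.congr (Eventually.of_forall fun y => ?_)
  simp only [newtonKernel, smul_eq_mul]
  ring

/-- For densities of compact support, derivatives commute with the Newtonian potential. -/
theorem fderiv_newtonPotential_of_hasCompactSupport (hn : 2 ≤ n) (hγ : ContDiff ℝ 1 γ)
    (hs : HasCompactSupport γ) (x v : Eucl n) :
    fderiv ℝ (newtonPotential γ) x v = newtonPotential (fun z => fderiv ℝ γ z v) x :=
  fderiv_conv_right measurable_newtonKernel.aestronglyMeasurable hγ
    (convDominated_of_hasCompactSupport_right (locallyIntegrable_newtonKernel hn) hγ.continuous hs)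
    (convDominated_of_hasCompactSupport_right (locallyIntegrable_newtonKernel hn)
      (hγ.continuous_fderiv one_ne_zero) (hs.fderiv ℝ)) x v

end Potential

/-! ### Cutoffs and passage to the limit -/

section Limits

variable {n : ℕ} {F G : Type*} [NormedAddCommGroup F] [NormedSpace ℝ F] [NormedAddCommGroup G]
  [NormedSpace ℝ G] {γ : Eucl n → F}

theorem clm_eq_sum_smulRight (T : Eucl n →L[ℝ] F) :
    T = ∑ i, (innerSL ℝ (stdFrame n i)).smulRight (T (stdFrame n i)) := by
  ext v
  conv_lhs => rw [← (stdFrame n).sum_repr' v]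
  simp

theorem tendsto_clm_of_apply {ι : Type*} {l : Filter ι} {T : ι → Eucl n →L[ℝ] F}
    {T₀ : Eucl n →L[ℝ] F}
    (h : ∀ i, Tendsto (fun k => T k (stdFrame n i)) l (𝓝 (T₀ (stdFrame n i)))) :
    Tendsto T l (𝓝 T₀) := by
  rw [clm_eq_sum_smulRight T₀, funext fun k => clm_eq_sum_smulRight (T k)]
  exact tendsto_finsetSum _ fun i _ =>
    ((ContinuousLinearMap.smulRightL ℝ (Eucl n) F (innerSL ℝ (stdFrame n i))).continuous.tendsto
      _).comp (h i)

/-- The cutoff at radius `k + 1`. -/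
def cutoffAt (k : ℕ) (y : Eucl n) : ℝ := cutoff (((k : ℝ) + 1)⁻¹ • y)

theorem contDiff_cutoffAt (k : ℕ) : ContDiff ℝ 1 (cutoffAt (n := n) k) :=
  (contDiff_cutoff 1).comp (contDiff_const_smul _)

theorem cutoffAt_eq_one {k : ℕ} {y : Eucl n} (hy : ‖y‖ ≤ (k : ℝ) + 1) : cutoffAt k y = 1 := by
  refine cutoff_eq_one ?_
  rw [norm_smul, Real.norm_of_nonneg (by positivity), inv_mul_le_iff₀ (by positivity)]
  simpa using hy

theorem cutoffAt_eq_zero {k : ℕ} {y : Eucl n} (hy : 2 * ((k : ℝ) + 1) ≤ ‖y‖) :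
    cutoffAt k y = 0 := by
  refine cutoff_eq_zero ?_
  have : 2 ≤ ‖((k : ℝ) + 1)⁻¹ • y‖ := by
    rw [norm_smul, Real.norm_of_nonneg (by positivity), le_inv_mul_iff₀ (by positivity)]
    linarith
  nlinarith

theorem eventually_cutoffAt_eq_one (y : Eucl n) : ∀ᶠ k : ℕ in atTop, cutoffAt k y = 1 := by
  filter_upwards [eventually_ge_atTop ⌈‖y‖⌉₊] with k hk
  exact cutoffAt_eq_one (by linarith [Nat.ceil_le.1 hk])

theorem norm_cutoffAt_le (k : ℕ) (y : Eucl n) : ‖cutoffAt k y‖ ≤ 1 := by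
  have h := cutoff_mem_Icc (((k : ℝ) + 1)⁻¹ • y)
  rw [cutoffAt, Real.norm_of_nonneg h.1]
  exact h.2

theorem hasCompactSupport_cutoffAt (k : ℕ) : HasCompactSupport (cutoffAt (n := n) k) := by
  refine HasCompactSupport.intro (isCompact_closedBall 0 (2 * ((k : ℝ) + 1))) fun z hz =>
    cutoffAt_eq_zero ?_
  rw [mem_closedBall_zero_iff, not_le] at hz
  exact hz.le

theorem exists_bound_fderiv_cutoffAt (n : ℕ) :
    ∃ C : ℝ, 0 ≤ C ∧ ∀ (k : ℕ) (y : Eucl n), ‖fderiv ℝ (cutoffAt k) y‖ ≤ ((k : ℝ) + 1)⁻¹ * C := by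
  obtain ⟨C, hC⟩ := (hasCompactSupport_cutoff (n := n).fderiv ℝ).exists_bound_of_continuous
    ((contDiff_cutoff 1).continuous_fderiv one_ne_zero)
  refine ⟨C, (norm_nonneg _).trans (hC 0), fun k y => ?_⟩
  have e : fderiv ℝ (cutoffAt k) y = ((k : ℝ) + 1)⁻¹ • fderiv ℝ cutoff (((k : ℝ) + 1)⁻¹ • y) :=
    fderiv_comp_smul _
  rw [e, norm_smul, Real.norm_of_nonneg (by positivity)]
  gcongr
  exact hC _

theorem fderiv_cutoffAt_eq_zero_of_lt {k : ℕ} {y : Eucl n} (hy : ‖y‖ < (k : ℝ) + 1) :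
    fderiv ℝ (cutoffAt k) y = 0 := by
  have : cutoffAt k =ᶠ[𝓝 y] fun _ => 1 := by
    filter_upwards [(isOpen_lt continuous_norm continuous_const).mem_nhds hy] with z hz
    exact cutoffAt_eq_one (le_of_lt hz)
  rw [this.fderiv_eq]
  simp

theorem fderiv_cutoffAt_eq_zero_of_gt {k : ℕ} {y : Eucl n} (hy : 2 * ((k : ℝ) + 1) < ‖y‖) :
    fderiv ℝ (cutoffAt k) y = 0 := by
  have : cutoffAt k =ᶠ[𝓝 y] fun _ => 0 := by
    filter_upwards [(isOpen_lt continuous_const continuous_norm).mem_nhds hy] with z hz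
    exact cutoffAt_eq_zero (le_of_lt hz)
  rw [this.fderiv_eq]
  simp

theorem fderiv_cutoffAt_smul (hγ : ContDiff ℝ 1 γ) (k : ℕ) (y : Eucl n) :
    fderiv ℝ (fun y => cutoffAt k y • γ y) y =
      cutoffAt k y • fderiv ℝ γ y + (fderiv ℝ (cutoffAt k) y).smulRight (γ y) :=
  fderiv_fun_smul ((contDiff_cutoffAt k).differentiable one_ne_zero y)
    (hγ.differentiable one_ne_zero y)

theorem contDiff_cutoffAt_smul (hγ : ContDiff ℝ 1 γ) (k : ℕ) :
    ContDiff ℝ 1 fun y => cutoffAt k y • γ y := (contDiff_cutoffAt k).smul hγ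

theorem hasCompactSupport_cutoffAt_smul (γ : Eucl n → F) (k : ℕ) :
    HasCompactSupport fun y => cutoffAt k y • γ y := (hasCompactSupport_cutoffAt k).smul_right

variable [CompleteSpace F] [CompleteSpace G]

/-- For a density of compact support, a first-order operator with constant coefficients commutes
with the Newtonian potential. -/
theorem newtonPotential_comp_fderiv (hn : 2 ≤ n) (hγ : ContDiff ℝ 1 γ) (hs : HasCompactSupport γ)
    (L : (Eucl n →L[ℝ] F) →L[ℝ] G) :
    newtonPotential (fun y => L (fderiv ℝ γ y)) = fun x => L (fderiv ℝ (newtonPotential γ) x) := by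
  funext x
  have hc := hγ.continuous_fderiv one_ne_zero
  have hi : Integrable fun y => newtonKernel n (x - y) • fderiv ℝ γ y :=
    (newtonConverges_of_hasCompactSupport hn hc (hs.fderiv ℝ)).integrable hc.aestronglyMeasurable x
  have e : fderiv ℝ (newtonPotential γ) x = ∫ y, newtonKernel n (x - y) • fderiv ℝ γ y := by
    ext v
    rw [fderiv_newtonPotential_of_hasCompactSupport hn hγ hs, ContinuousLinearMap.integral_apply hi]
    rfl
  rw [e, ← ContinuousLinearMap.integral_comp_comm L hi]
  simp only [map_smul]
  rfl

/-- Truncating the density does not change the gradient of the potential in the limit. -/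
theorem tendsto_fderiv_newtonPotential_cutoffAt (hn : 2 ≤ n) (h : NewtonConverges γ)
    (hγ : Continuous γ) (x : Eucl n) :
    Tendsto (fun k => fderiv ℝ (newtonPotential fun y => cutoffAt k y • γ y) x) atTop
      (𝓝 (fderiv ℝ (newtonPotential γ) x)) := by
  refine tendsto_clm_of_apply fun i => ?_
  have hc : ∀ k, Continuous fun y => cutoffAt k y • γ y := fun k =>
    (contDiff_cutoffAt k).continuous.smul hγ
  have hs : ∀ k, HasCompactSupport fun y => cutoffAt k y • γ y :=
    fun k => hasCompactSupport_cutoffAt_smul γ k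
  simp_rw [fun k => fderiv_newtonPotential hn
    (newtonConverges_of_hasCompactSupport hn (hc k) (hs k)) (hc k) x (stdFrame n i), fderiv_newtonPotential hn h hγ]
  refine tendsto_integral_of_dominated_convergence _ (fun k => ?_)
    (h.integrable_fderiv hn hγ x (stdFrame n i)).norm (fun k => ?_) ?_
  · exact ((newtonConverges_of_hasCompactSupport hn (hc k) (hs k)).integrable_fderiv hn
      (hc k) x _).aestronglyMeasurable
  · refine Eventually.of_forall fun y => ?_
    rw [norm_smul, norm_smul, norm_smul]
    gcongr
    exact mul_le_of_le_one_left (norm_nonneg _) (norm_cutoffAt_le k y)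
  · refine Eventually.of_forall fun y => tendsto_const_nhds.congr' ?_
    filter_upwards [eventually_cutoffAt_eq_one y] with k hk
    rw [hk, one_smul]

/-- If a first-order operator with constant coefficients annihilates the density, then it
annihilates the Newtonian potential. No decay of the derivatives of the density is needed: the
density is truncated, and the gradients of the cutoffs tend to `0` uniformly. -/
theorem comp_fderiv_newtonPotential_eq_zero (hn : 2 ≤ n) (h : NewtonConverges γ)
    (hγ : ContDiff ℝ 1 γ) (L : (Eucl n →L[ℝ] F) →L[ℝ] G) (hL : ∀ y, L (fderiv ℝ γ y) = 0)
    (x : Eucl n) : L (fderiv ℝ (newtonPotential γ) x) = 0 := by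
  have h1 := (L.continuous.tendsto _).comp
    (tendsto_fderiv_newtonPotential_cutoffAt hn h hγ.continuous x)
  refine tendsto_nhds_unique h1 ?_
  obtain ⟨C, hC, hle⟩ := exists_bound_fderiv_cutoffAt n
  have h0 : Tendsto (fun k : ℕ => (‖L‖ * C * ∫ y, ‖γ y‖ / ‖x - y‖ ^ (n - 2)) * ((k : ℝ) + 1)⁻¹)
      atTop (𝓝 0) := by
    simpa [one_div] using (tendsto_one_div_add_atTop_nhds_zero_nat (𝕜 := ℝ)).const_mul
      (‖L‖ * C * ∫ y, ‖γ y‖ / ‖x - y‖ ^ (n - 2))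
  refine squeeze_zero_norm (fun k => ?_) h0
  have e := congrFun (newtonPotential_comp_fderiv hn (contDiff_cutoffAt_smul hγ k)
    (hasCompactSupport_cutoffAt_smul γ k) L) x
  simp only [Function.comp_apply]
  rw [← e, newtonPotential, conv, mul_right_comm, ← integral_const_mul]
  refine norm_integral_le_of_norm_le ((h x).const_mul _) (Eventually.of_forall fun y => ?_)
  rw [fderiv_cutoffAt_smul hγ, map_add, map_smul, hL, smul_zero, zero_add, norm_smul,
    norm_newtonKernel]
  calc (‖x - y‖ ^ (n - 2))⁻¹ * ‖L ((fderiv ℝ (cutoffAt k) y).smulRight (γ y))‖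
      ≤ (‖x - y‖ ^ (n - 2))⁻¹ * (‖L‖ * (((k : ℝ) + 1)⁻¹ * C * ‖γ y‖)) := by
        gcongr
        refine (L.le_opNorm _).trans ?_
        rw [ContinuousLinearMap.norm_smulRight_apply]
        gcongr
        exact hle k y
    _ = _ := by ring

omit [CompleteSpace F] in
/-- The boundary terms in the decomposition: for `α` vanishing at infinity, the gradient of the
potential of `L (∇χ_R ⊗ α)` tends to `0`. The annulus `R ≤ |y| ≤ 2R` has volume `O(R^n)`, on which
the gradient of the kernel is `O(R^{-(n-1)})`, the gradient of the cutoff `O(R^{-1})` and `α` is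
`o(1)`. -/
theorem tendsto_fderiv_newtonPotential_boundary (hn : 2 ≤ n) {α : Eucl n → F}
    (hα : Continuous α) (h0 : Tendsto α (cocompact (Eucl n)) (𝓝 0))
    (L : (Eucl n →L[ℝ] F) →L[ℝ] G) (x : Eucl n) :
    Tendsto (fun k => fderiv ℝ (newtonPotential fun y =>
      L ((fderiv ℝ (cutoffAt k) y).smulRight (α y))) x) atTop (𝓝 0) := by
  have hnt := nontrivial_eucl (n := n) (by omega)
  have hn' : (2 : ℝ) ≤ n := by exact_mod_cast hn
  have hn2 : (0 : ℝ) ≤ n - 2 := by linarith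
  refine tendsto_clm_of_apply fun i => ?_
  let β : ℕ → Eucl n → G := fun k y => L ((fderiv ℝ (cutoffAt k) y).smulRight (α y))
  have hc : ∀ k, Continuous (β k) := fun k => by
    have h1 := (contDiff_cutoffAt (n := n) k).continuous_fderiv one_ne_zero
    have h2 : Continuous fun y => ContinuousLinearMap.smulRightL ℝ (Eucl n) F
      (fderiv ℝ (cutoffAt k) y) (α y) := by fun_prop
    exact L.continuous.comp h2
  have hzero : ∀ k y, fderiv ℝ (cutoffAt k) y = 0 → β k y = 0 := fun k y hy => by
    simp only [β, hy]
    rw [show (0 : Eucl n →L[ℝ] ℝ).smulRight (α y) = 0 by ext; simp, map_zero]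
  have hs : ∀ k, HasCompactSupport (β k) := fun k =>
    HasCompactSupport.intro (hasCompactSupport_cutoffAt (n := n) k |>.fderiv ℝ) fun y hy =>
      hzero k y (image_eq_zero_of_notMem_tsupport hy)
  have hconv : ∀ k, NewtonConverges (β k) := fun k =>
    newtonConverges_of_hasCompactSupport hn (hc k) (hs k)
  obtain ⟨C, hC, hle⟩ := exists_bound_fderiv_cutoffAt n
  -- The constant collecting the factors of the estimate.
  let M : ℝ := ((n : ℝ) - 2) * 2 ^ (n - 1) * (‖L‖ * C) * 2 ^ n *
    (volume : Measure (Eucl n)).real (Metric.ball 0 1)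
  have hM : 0 ≤ M := by positivity
  rw [zero_apply, tendsto_zero_iff_norm_tendsto_zero]
  have key : ∀ ε : ℝ, 0 < ε → ∀ᶠ k : ℕ in atTop,
      ‖fderiv ℝ (newtonPotential (β k)) x (stdFrame n i)‖ ≤ M * ε := fun ε hε => by
    have hev : ∀ᶠ y in cocompact (Eucl n), ‖α y‖ ≤ ε := by
      filter_upwards [(tendsto_zero_iff_norm_tendsto_zero.1 h0).eventually_lt_const hε] with y hy
      exact hy.le
    rw [← Metric.cobounded_eq_cocompact, ← comap_norm_atTop, eventually_comap] at hev
    obtain ⟨R₀, hR₀⟩ := eventually_atTop.1 hev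
    filter_upwards [eventually_ge_atTop ⌈max R₀ (2 * ‖x‖)⌉₊] with k hk
    have hk' : max R₀ (2 * ‖x‖) ≤ k := Nat.ceil_le.1 hk
    have hkR : R₀ ≤ k := (le_max_left _ _).trans hk'
    have hkx : 2 * ‖x‖ ≤ k := (le_max_right _ _).trans hk'
    set R : ℝ := (k : ℝ) + 1 with hR
    have hRpos : 0 < R := by positivity
    rw [fderiv_newtonPotential hn (hconv k) (hc k), conv]
    have hpt : ∀ y, ‖fderiv ℝ (newtonKernel n) (x - y) (stdFrame n i) • β k y‖ ≤
        (((n : ℝ) - 2) * ((R / 2) ^ (n - 1))⁻¹) * (‖L‖ * (R⁻¹ * C * ε)) := fun y => by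
      rcases lt_or_ge ‖y‖ R with hy | hy
      · rw [hzero k y (fderiv_cutoffAt_eq_zero_of_lt hy), smul_zero, norm_zero]
        positivity
      · have hxy : R / 2 ≤ ‖x - y‖ := by
          have := norm_sub_norm_le y x
          rw [norm_sub_rev] at this
          linarith
        have hne : x - y ≠ 0 := norm_pos_iff.1 (by linarith)
        have hαy : ‖α y‖ ≤ ε := hR₀ ‖y‖ (by linarith) y rfl
        rw [norm_smul]
        gcongr
        · refine (ContinuousLinearMap.le_opNorm _ _).trans ?_
          rw [(stdFrame n).norm_eq_one, mul_one, norm_fderiv_newtonKernel hn hne]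
          gcongr
        · refine (L.le_opNorm _).trans ?_
          rw [ContinuousLinearMap.norm_smulRight_apply]
          gcongr
          exact hle k y
    rw [← setIntegral_eq_integral_of_forall_compl_eq_zero
      (s := Metric.closedBall (0 : Eucl n) (2 * R)) fun y hy => by
        rw [mem_closedBall_zero_iff, not_le] at hy
        rw [hzero k y (fderiv_cutoffAt_eq_zero_of_gt hy), smul_zero]]
    refine (norm_setIntegral_le_of_norm_le_const measure_closedBall_lt_top
      fun y _ => hpt y).trans_eq ?_
    rw [Measure.addHaar_real_closedBall _ _ (by positivity), finrank_euclideanSpace,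
      Fintype.card_fin]
    have hp : R ^ n = R ^ (n - 1) * R := by rw [← pow_succ]; congr 1; omega
    simp only [M, div_pow, mul_pow, hp]
    field_simp
  rw [Metric.tendsto_nhds]
  intro ε hε
  filter_upwards [key (ε / (2 * (M + 1))) (by positivity)] with k hk
  rw [dist_zero_right, norm_norm]
  refine hk.trans_lt ?_
  rw [mul_div_assoc', div_lt_iff₀ (by positivity)]
  nlinarith

end Limits

/-! ### Densities that decay faster than the inverse square -/

section Decay

variable {n : ℕ} {F : Type*} [NormedAddCommGroup F] [NormedSpace ℝ F] {γ : Eucl n → F}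

theorem rpow_neg_mul_rpow_neg_le {a b u v : ℝ} (ha : 1 ≤ a) (hb : 1 ≤ b) (hu : 0 ≤ u)
    (hv : 0 ≤ v) : a ^ (-u) * b ^ (-v) ≤ a ^ (-(u + v)) + b ^ (-(u + v)) := by
  have ha0 : 0 < a := by linarith
  have hb0 : 0 < b := by linarith
  rcases le_total a b with hab | hab
  · refine le_trans ?_ (le_add_of_nonneg_right (by positivity))
    rw [neg_add, Real.rpow_add ha0]
    exact mul_le_mul_of_nonneg_left (Real.rpow_le_rpow_of_nonpos ha0 hab (by linarith))
      (by positivity)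
  · refine le_trans ?_ (le_add_of_nonneg_left (by positivity))
    rw [neg_add, Real.rpow_add hb0]
    exact mul_le_mul_of_nonneg_right (Real.rpow_le_rpow_of_nonpos hb0 hab (by linarith))
      (by positivity)

theorem integrable_one_add_norm_translate {r : ℝ} (hr : (n : ℝ) < r) (x : Eucl n) :
    Integrable fun y : Eucl n => (1 + ‖x - y‖) ^ (-r) + (1 + ‖y‖) ^ (-r) := by
  have h : Integrable fun y : Eucl n => (1 + ‖y‖) ^ (-r) :=
    integrable_one_add_norm (by simpa using hr)
  exact (h.comp_sub_left x).add h

theorem integral_one_add_norm_translate {r : ℝ} (hr : (n : ℝ) < r) (x : Eucl n) :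
    ∫ y : Eucl n, ((1 + ‖x - y‖) ^ (-r) + (1 + ‖y‖) ^ (-r)) =
      2 * ∫ y : Eucl n, (1 + ‖y‖) ^ (-r) := by
  have h : Integrable fun y : Eucl n => (1 + ‖y‖) ^ (-r) :=
    integrable_one_add_norm (by simpa using hr)
  rw [integral_add (h.comp_sub_left x) h,
    integral_sub_left_eq_self (fun y : Eucl n => (1 + ‖y‖) ^ (-r)) volume x, two_mul]

theorem pow_inv_eq_rpow_neg {a : ℝ} (ha : 0 ≤ a) (m : ℕ) : (a ^ m)⁻¹ = a ^ (-(m : ℝ)) := by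
  rw [Real.rpow_neg ha, Real.rpow_natCast]

omit [NormedSpace ℝ F] in
/-- The Newtonian potential of a density which is `O((1 + |y|)^{-s})`, `s > 2`, converges. -/
theorem newtonConverges_of_decay (hn : 2 ≤ n) (hγ : Continuous γ) {s C : ℝ} (hs : 2 < s)
    (hC : ∀ y, ‖γ y‖ ≤ C * (1 + ‖y‖) ^ (-s)) : NewtonConverges γ := fun x => by
  have hC0 : 0 ≤ C := by
    have := (norm_nonneg _).trans (hC 0)
    simpa using this
  have hn' : (2 : ℝ) ≤ n := by exact_mod_cast hn
  obtain ⟨C₁, hC₁, hle⟩ := exists_bound_farKernel (n := n) one_pos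
  have h1 := (integrable_conv_swap (κ := nearKernel n 1) (γ := fun y => ‖γ y‖)).2
    (integrable_conv_right (measurable_nearKernel 1).aestronglyMeasurable hγ.norm
      (convDominated_nearKernel hn one_pos hγ.norm) x)
  have h2 : Integrable fun y => farKernel n 1 (x - y) • ‖γ y‖ := by
    refine ((integrable_one_add_norm_translate (n := n) (r := ((n - 2 : ℕ) : ℝ) + s)
      (by rw [Nat.cast_sub hn]; push_cast; linarith) x).const_mul (C₁ * C)).mono'
      (Continuous.aestronglyMeasurable ?_) (Eventually.of_forall fun y => ?_)
    · have := (contDiff_farKernel (n := n) one_pos 0).continuous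
      fun_prop
    · rw [norm_smul, norm_norm]
      have hxy := norm_nonneg (x - y)
      have hy := norm_nonneg y
      calc ‖farKernel n 1 (x - y)‖ * ‖γ y‖
          ≤ (C₁ * (1 + ‖x - y‖) ^ (-((n - 2 : ℕ) : ℝ))) * (C * (1 + ‖y‖) ^ (-s)) := by
            gcongr
            · rw [← pow_inv_eq_rpow_neg (by positivity)]; exact hle _
            · exact hC y
        _ = C₁ * C * ((1 + ‖x - y‖) ^ (-((n - 2 : ℕ) : ℝ)) * (1 + ‖y‖) ^ (-s)) := by ring
        _ ≤ _ := by
            gcongr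
            exact rpow_neg_mul_rpow_neg_le (by linarith) (by linarith) (by positivity) (by linarith)
  refine (h1.add h2).congr (Eventually.of_forall fun y => ?_)
  simp only [Pi.add_apply, farKernel, smul_eq_mul, newtonKernel]
  ring

/-- The gradient of the Newtonian potential of a density which is `O((1 + |y|)^{-s})`, `s > 2`,
tends to `0` at infinity. -/
theorem tendsto_fderiv_newtonPotential_of_decay [CompleteSpace F] (hn : 2 ≤ n)
    (hγ : Continuous γ) {s C : ℝ} (hs : 2 < s) (hC : ∀ y, ‖γ y‖ ≤ C * (1 + ‖y‖) ^ (-s)) :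
    Tendsto (fderiv ℝ (newtonPotential γ)) (cocompact (Eucl n)) (𝓝 0) := by
  have hC0 : 0 ≤ C := by
    have := (norm_nonneg _).trans (hC 0)
    simpa using this
  have hn' : (2 : ℝ) ≤ n := by exact_mod_cast hn
  have hcast : ((n - 1 : ℕ) : ℝ) = n - 1 := by rw [Nat.cast_sub (by omega)]; simp
  have hconv := newtonConverges_of_decay hn hγ hs hC
  refine tendsto_clm_of_apply fun i => ?_
  rw [zero_apply]
  obtain ⟨C₁, hC₁, hle⟩ := exists_bound_fderiv_farKernel hn one_pos
  -- Both parts are `O((1 + |x|)^{-1/2})`. For the far part, a factor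
  -- `(1 + |x - y|)^{-1/2} (1 + |y|)^{-1/2} ≤ (1 + |x|)^{-1/2}` is split off; what is left has total
  -- exponent `n - 2 + s > n` and is integrable uniformly in `x`.
  have hpeetre : ∀ x y : Eucl n, 1 + ‖x‖ ≤ (1 + ‖x - y‖) * (1 + ‖y‖) := fun x y => by
    have : ‖x‖ ≤ ‖x - y‖ + ‖y‖ := by simpa using norm_add_le (x - y) y
    nlinarith [norm_nonneg (x - y), norm_nonneg y]
  have hnear : ∀ x : Eucl n, ‖conv (fun z => fderiv ℝ (nearKernel n 1) z (stdFrame n i)) γ x‖ ≤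
      (C * 2 ^ (1 / 2 : ℝ) * ∫ z, ‖fderiv ℝ (nearKernel n 1) z‖) *
        (1 + ‖x‖) ^ (-(1 / 2) : ℝ) := fun x => by
    rw [conv_apply', mul_right_comm]
    refine norm_integral_kernel_le (γ := γ) (x := x) (integrable_fderiv_nearKernel hn one_pos)
      (r := 1) (fun t ht => fderiv_nearKernel_eq_zero one_pos (by simpa using ht)) (fun t ht => ?_)
      fun t => ?_
    · have h1 : 1 + ‖x‖ ≤ 2 * (1 + ‖x - t‖) := by
        have : ‖x‖ ≤ ‖x - t‖ + ‖t‖ := by simpa using norm_add_le (x - t) t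
        linarith [norm_nonneg (x - t)]
      have hx := norm_nonneg x
      have hxt := norm_nonneg (x - t)
      refine (hC _).trans ?_
      rw [mul_assoc]
      gcongr
      calc (1 + ‖x - t‖) ^ (-s) ≤ (1 + ‖x - t‖) ^ (-(1 / 2) : ℝ) :=
            Real.rpow_le_rpow_of_exponent_le (by linarith) (by linarith)
        _ = 2 ^ (1 / 2 : ℝ) * (2 * (1 + ‖x - t‖)) ^ (-(1 / 2) : ℝ) := by
            rw [Real.mul_rpow (by norm_num) (by positivity), ← mul_assoc,
              ← Real.rpow_add (by norm_num)]
            norm_num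
        _ ≤ 2 ^ (1 / 2 : ℝ) * (1 + ‖x‖) ^ (-(1 / 2) : ℝ) := by
            exact mul_le_mul_of_nonneg_left
              (Real.rpow_le_rpow_of_nonpos (by positivity) h1 (by norm_num)) (by positivity)
    · rw [norm_smul]
      gcongr
      refine ((fderiv ℝ (nearKernel n 1) t).le_opNorm _).trans ?_
      rw [(stdFrame n).norm_eq_one, mul_one]
  have hr : (n : ℝ) < ((n : ℝ) - 1 - 1 / 2) + (s - 1 / 2) := by linarith
  have hfar : ∀ x : Eucl n, ‖conv (fun z => fderiv ℝ (farKernel n 1) z (stdFrame n i)) γ x‖ ≤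
      (C₁ * C * (2 * ∫ y : Eucl n, (1 + ‖y‖) ^ (-(((n : ℝ) - 1 - 1 / 2) + (s - 1 / 2))))) *
        (1 + ‖x‖) ^ (-(1 / 2) : ℝ) := fun x => by
    rw [← integral_one_add_norm_translate hr x, mul_right_comm, ← integral_const_mul]
    refine norm_integral_le_of_norm_le ((integrable_one_add_norm_translate hr x).const_mul _)
      (Eventually.of_forall fun y => ?_)
    have hx := norm_nonneg x
    have hxy := norm_nonneg (x - y)
    have hy := norm_nonneg y
    have h1 : ‖fderiv ℝ (farKernel n 1) (x - y) (stdFrame n i)‖ ≤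
        C₁ * (1 + ‖x - y‖) ^ (-((n : ℝ) - 1)) := by
      refine (ContinuousLinearMap.le_opNorm _ _).trans ?_
      rw [(stdFrame n).norm_eq_one, mul_one, ← hcast, ← pow_inv_eq_rpow_neg (by positivity)]
      exact hle _
    have h2 : (1 + ‖x - y‖) ^ (-(1 / 2) : ℝ) * (1 + ‖y‖) ^ (-(1 / 2) : ℝ) ≤
        (1 + ‖x‖) ^ (-(1 / 2) : ℝ) := by
      rw [← Real.mul_rpow (by positivity) (by positivity)]
      exact Real.rpow_le_rpow_of_nonpos (by positivity) (hpeetre x y) (by norm_num)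
    calc ‖fderiv ℝ (farKernel n 1) (x - y) (stdFrame n i) • γ y‖
        ≤ (C₁ * (1 + ‖x - y‖) ^ (-((n : ℝ) - 1))) * (C * (1 + ‖y‖) ^ (-s)) := by
          rw [norm_smul]
          gcongr
          exact hC y
      _ = C₁ * C * ((1 + ‖x - y‖) ^ (-(1 / 2) : ℝ) * (1 + ‖y‖) ^ (-(1 / 2) : ℝ)) *
          ((1 + ‖x - y‖) ^ (-((n : ℝ) - 1 - 1 / 2)) * (1 + ‖y‖) ^ (-(s - 1 / 2))) := by
          have e1 : (1 + ‖x - y‖) ^ (-((n : ℝ) - 1)) = (1 + ‖x - y‖) ^ (-(1 / 2) : ℝ) *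
              (1 + ‖x - y‖) ^ (-((n : ℝ) - 1 - 1 / 2)) := by
            rw [← Real.rpow_add (by positivity)]; congr 1; ring
          have e2 : (1 + ‖y‖) ^ (-s) = (1 + ‖y‖) ^ (-(1 / 2) : ℝ) *
              (1 + ‖y‖) ^ (-(s - 1 / 2)) := by
            rw [← Real.rpow_add (by positivity)]; congr 1; ring
          rw [e1, e2]; ring
      _ ≤ C₁ * C * (1 + ‖x‖) ^ (-(1 / 2) : ℝ) * _ := by
          gcongr
          exact rpow_neg_mul_rpow_neg_le (by linarith) (by linarith) (by linarith) (by linarith)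
  have hlim : Tendsto (fun x : Eucl n => (1 + ‖x‖) ^ (-(1 / 2) : ℝ)) (cocompact (Eucl n)) (𝓝 0) :=
    (tendsto_rpow_neg_atTop (by norm_num)).comp
      (tendsto_atTop_add_const_left _ _ tendsto_norm_cocompact_atTop)
  have h0 := (hlim.const_mul (C * 2 ^ (1 / 2 : ℝ) * ∫ z, ‖fderiv ℝ (nearKernel n 1) z‖)).add
    (hlim.const_mul
      (C₁ * C * (2 * ∫ y : Eucl n, (1 + ‖y‖) ^ (-(((n : ℝ) - 1 - 1 / 2) + (s - 1 / 2))))))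
  rw [mul_zero, mul_zero, add_zero] at h0
  refine squeeze_zero_norm (fun x => ?_) h0
  rw [fderiv_newtonPotential_eq_add hn hconv hγ one_pos, fderiv_conv_nearKernel hn one_pos hγ]
  exact (norm_add_le _ _).trans (add_le_add (hnear x) (hfar x))

end Decay

/-! ### Components of a form in the monomials of a basis -/

section Expansion

variable {n j : ℕ}

theorem monomial_apply (b : OrthonormalBasis (Fin n) ℝ (Eucl n)) (s : Fin j → Fin n)
    (v : Fin j → Eucl n) :
    monomial b s v = (Matrix.of fun i r => inner ℝ (b (s r)) (v i)).det := rfl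

theorem basisForm_apply_orderEmb (b : OrthonormalBasis (Fin n) ℝ (Eucl n))
    (A B : {A : Finset (Fin n) // A.card = j}) :
    basisForm b A (fun r => b (B.1.orderEmbOfFin B.2 r)) = if A = B then 1 else 0 := by
  rw [basisForm, monomial_apply]
  split_ifs with h
  · subst h
    have e : (Matrix.of fun i r => inner ℝ (b (A.1.orderEmbOfFin A.2 r))
        (b (A.1.orderEmbOfFin A.2 i))) = (1 : Matrix (Fin j) (Fin j) ℝ) := by
      ext i r
      rw [Matrix.of_apply, OrthonormalBasis.inner_eq_ite, Matrix.one_apply]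
      simp [eq_comm]
    rw [e, Matrix.det_one]
  · obtain ⟨i, hiB, hiA⟩ : ∃ i ∈ B.1, i ∉ A.1 := by
      by_contra! hc
      exact h (Subtype.ext (Finset.eq_of_subset_of_card_le hc (by rw [A.2, B.2])).symm)
    obtain ⟨r, hr⟩ : ∃ r, B.1.orderEmbOfFin B.2 r = i := by
      have : i ∈ Set.range (B.1.orderEmbOfFin B.2) := by simpa using hiB
      exact this
    refine Matrix.det_eq_zero_of_row_eq_zero r fun l => ?_
    rw [Matrix.of_apply, OrthonormalBasis.inner_eq_ite, if_neg]
    rw [hr]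
    rintro rfl
    exact hiA (Finset.orderEmbOfFin_mem _ _ _)

theorem exists_perm_orderEmbOfFin {v : Fin j → Fin n} (hv : Function.Injective v) :
    ∃ (B : {A : Finset (Fin n) // A.card = j}) (σ : Equiv.Perm (Fin j)),
      v = B.1.orderEmbOfFin B.2 ∘ σ := by
  let B : Finset (Fin n) := Finset.univ.image v
  have hB : B.card = j := by
    rw [Finset.card_image_of_injective _ hv, Finset.card_univ, Fintype.card_fin]
  have hmem : ∀ i, v i ∈ B := fun i => Finset.mem_image_of_mem v (Finset.mem_univ i)
  let f : Fin j → Fin j := fun i => (B.orderIsoOfFin hB).symm ⟨v i, hmem i⟩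
  have hf : Function.Injective f := fun i l h => by
    have := (B.orderIsoOfFin hB).symm.injective h
    exact hv (congrArg Subtype.val this)
  refine ⟨⟨B, hB⟩, Equiv.ofBijective f (Finite.injective_iff_bijective.1 hf), ?_⟩
  funext i
  simp [f, Finset.orderEmbOfFin]

/-- The expansion of an exterior form in the monomials `ω^A`. -/
theorem form_eq_sum_basisForm (b : OrthonormalBasis (Fin n) ℝ (Eucl n)) (c : Form n j) :
    c = ∑ A : {A : Finset (Fin n) // A.card = j},
      c (fun r => b (A.1.orderEmbOfFin A.2 r)) • basisForm b A := by
  apply ContinuousAlternatingMap.toAlternatingMap_injective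
  refine Module.Basis.ext_alternating b.toBasis fun v hv => ?_
  obtain ⟨B, σ, rfl⟩ := exists_perm_orderEmbOfFin hv
  simp only [OrthonormalBasis.coe_toBasis]
  change c.toAlternatingMap ((fun r => b (B.1.orderEmbOfFin B.2 r)) ∘ σ) =
    (∑ A : {A : Finset (Fin n) // A.card = j},
      c (fun r => b (A.1.orderEmbOfFin A.2 r)) • basisForm b A).toAlternatingMap
        ((fun r => b (B.1.orderEmbOfFin B.2 r)) ∘ σ)
  rw [AlternatingMap.map_perm, AlternatingMap.map_perm]
  congr 1
  change c _ = (∑ A : {A : Finset (Fin n) // A.card = j},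
      c (fun r => b (A.1.orderEmbOfFin A.2 r)) • basisForm b A) _
  rw [ContinuousAlternatingMap.sum_apply]
  simp [basisForm_apply_orderEmb]

/-- The coefficient of `c ∧ d` as a linear functional of `c`. -/
def wedgeCoeff {q : ℕ} (d : Form n q) : Form n j →ₗ[ℝ] ℝ where
  toFun c := topCoeff (wedge c d)
  map_add' c c' := by
    have h : wedge (c + c') d = wedge c d + wedge c' d := by
      ext v
      change (LinearMap.mul' ℝ ℝ) (((c + c').toAlternatingMap.domCoprod
        d.toAlternatingMap) (fun x => v (finSumFinEquiv x))) = (LinearMap.mul' ℝ ℝ)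
          ((c.toAlternatingMap.domCoprod d.toAlternatingMap) (fun x => v (finSumFinEquiv x))) +
          (LinearMap.mul' ℝ ℝ)
          ((c'.toAlternatingMap.domCoprod d.toAlternatingMap) (fun x => v (finSumFinEquiv x)))
      rw [ContinuousAlternatingMap.toAlternatingMap_add, ← AlternatingMap.domCoprod'_apply,
        TensorProduct.add_tmul, map_add]
      simp
    rw [h]
    unfold topCoeff
    split_ifs <;> simp
  map_smul' t c := by
    have h : wedge (t • c) d = t • wedge c d := by
      ext v
      change (LinearMap.mul' ℝ ℝ) (((t • c).toAlternatingMap.domCoprod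
        d.toAlternatingMap) (fun x => v (finSumFinEquiv x))) = t * (LinearMap.mul' ℝ ℝ)
          ((c.toAlternatingMap.domCoprod d.toAlternatingMap) (fun x => v (finSumFinEquiv x)))
      rw [ContinuousAlternatingMap.toAlternatingMap_smul, ← AlternatingMap.domCoprod'_apply,
        ← TensorProduct.smul_tmul', map_smul]
      simp
    rw [h]
    unfold topCoeff
    split_ifs <;> simp

theorem wedgeCoeff_basisForm_complForm (b : OrthonormalBasis (Fin n) ℝ (Eucl n))
    (A B : {A : Finset (Fin n) // A.card = j}) :
    topCoeff (wedge (basisForm b B) (complForm b A)) = if B = A then 1 else 0 := by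
  split_ifs with h
  · subst h
    exact basisForm_wedge_complForm b B
  · -- A common factor `ω^i`, `i ∈ B \ A`, makes a determinant with two equal columns.
    obtain ⟨i, hiB, hiA⟩ : ∃ i ∈ B.1, i ∉ A.1 := by
      by_contra! hc
      exact h (Subtype.ext (Finset.eq_of_subset_of_card_le hc (by rw [A.2, B.2])))
    obtain ⟨r, hr⟩ : ∃ r, B.1.orderEmbOfFin B.2 r = i := by
      have : i ∈ Set.range (B.1.orderEmbOfFin B.2) := by simpa using hiB
      exact this
    obtain ⟨l, hl⟩ : ∃ l, A.1ᶜ.orderEmbOfFin rfl l = i := by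
      have : i ∈ Set.range (A.1ᶜ.orderEmbOfFin rfl) := by simpa using hiA
      exact this
    have hw : wedge (basisForm b B) (basisForm b ⟨A.1ᶜ, rfl⟩) = 0 := by
      ext v
      rw [basisForm, basisForm, wedge_monomial_apply]
      refine Matrix.det_zero_of_column_eq (i := Sum.inl r) (j := Sum.inr l) (by simp) fun x => ?_
      simp [hr, hl]
    have hs : ∀ (t : ℝ) (g : Form n j) (g' : Form n (A.1ᶜ).card),
        wedge g (t • g') = t • wedge g g' := fun t g g' => by
      ext v
      change (LinearMap.mul' ℝ ℝ) ((g.toAlternatingMap.domCoprod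
        (t • g'.toAlternatingMap)) (fun x => v (finSumFinEquiv x))) = t * (LinearMap.mul' ℝ ℝ)
          ((g.toAlternatingMap.domCoprod g'.toAlternatingMap) (fun x => v (finSumFinEquiv x)))
      rw [← AlternatingMap.domCoprod'_apply, TensorProduct.tmul_smul, map_smul]
      simp
    rw [complForm, hs, hw, smul_zero]
    unfold topCoeff
    split_ifs <;> simp

/-- The coefficient of `c ∧ ω^Ā` is the component of `c` along `ω^A`. -/
theorem topCoeff_wedge_complForm (b : OrthonormalBasis (Fin n) ℝ (Eucl n)) (c : Form n j)
    (A : {A : Finset (Fin n) // A.card = j}) :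
    topCoeff (wedge c (complForm b A)) = c (fun r => b (A.1.orderEmbOfFin A.2 r)) := by
  change wedgeCoeff (complForm b A) c = _
  conv_lhs => rw [form_eq_sum_basisForm b c]
  rw [map_sum]
  simp only [map_smul]
  have : ∀ B, wedgeCoeff (complForm b A) (basisForm b B) = if B = A then 1 else 0 :=
    fun B => wedgeCoeff_basisForm_complForm b A B
  simp [this]

/-- The potential `ω^A I_A[γ]` does not depend on the basis: it is the Newtonian potential of the
form-valued density `γ`. -/
theorem potential_eq_newtonPotential (b : OrthonormalBasis (Fin n) ℝ (Eucl n))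
    {γ : Eucl n → Form n j} (h : NewtonConverges γ) (hγ : AEStronglyMeasurable γ volume) :
    potential b γ = newtonPotential γ := by
  funext x
  rw [form_eq_sum_basisForm b (newtonPotential γ x), potential]
  refine Finset.sum_congr rfl fun A _ => ?_
  congr 1
  let ev := ContinuousAlternatingMap.apply ℝ (Eucl n) ℝ fun r => b (A.1.orderEmbOfFin A.2 r)
  change _ = ev (∫ y, newtonKernel n (x - y) • γ y)
  rw [← ContinuousLinearMap.integral_comp_comm ev (h.integrable hγ x)]
  refine integral_congr_ae (Eventually.of_forall fun y => ?_)
  have e : topCoeff ((1 / ‖x - y‖ ^ (n - 2)) • wedge (γ y) (complForm b A)) =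
      (1 / ‖x - y‖ ^ (n - 2)) * topCoeff (wedge (γ y) (complForm b A)) := by
    unfold topCoeff
    split_ifs <;> simp
  simp only [e, topCoeff_wedge_complForm, map_smul]
  rfl

end Expansion

/-! ### The exterior and the interior derivative -/

section Operators

variable {n j : ℕ}

/-- The symbol of the exterior derivative: `dβ = extSymbol (Dβ)`. -/
def extSymbol (n j : ℕ) : (Eucl n →L[ℝ] Form n j) →L[ℝ] Form n (j + 1) :=
  ContinuousAlternatingMap.alternatizeUncurryFinCLM ℝ (Eucl n) ℝ

/-- The symbol of the interior derivative: `δβ = intSymbol (Dβ)`. -/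
def intSymbol (n j : ℕ) : (Eucl n →L[ℝ] Form n (j + 1)) →L[ℝ] Form n j :=
  ∑ h : Fin n, (ContinuousLinearMap.apply ℝ (Form n j) (stdFrame n h)) ∘L
    (ContinuousAlternatingMap.curryLeftLI.toContinuousLinearMap ∘L
      ContinuousLinearMap.apply ℝ (Form n (j + 1)) (stdFrame n h))

theorem extDeriv_eq (β : Eucl n → Form n j) (x : Eucl n) :
    extDeriv β x = extSymbol n j (fderiv ℝ β x) := rfl

theorem intSymbol_apply (T : Eucl n →L[ℝ] Form n (j + 1)) :
    intSymbol n j T = ∑ h : Fin n, (T (stdFrame n h)).curryLeft (stdFrame n h) := by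
  simp [intSymbol]

theorem delta_eq (β : Eucl n → Form n (j + 1)) (x : Eucl n) :
    delta β x = intSymbol n j (fderiv ℝ β x) := by
  rw [intSymbol_apply]; rfl

/-- Contraction of `v` into `e ∧ c`: the terms `⟨e, v⟩ c` and `-e ∧ (v ⌟ c)`. -/
theorem extSymbol_apply_vecCons (T : Eucl n →L[ℝ] Form n (j + 1)) (v : Eucl n)
    (m : Fin (j + 1) → Eucl n) :
    extSymbol n (j + 1) T (Matrix.vecCons v m) = T v m -
      ∑ i : Fin (j + 1), (-1 : ℤ) ^ (i : ℕ) • T (m i) (Matrix.vecCons v (i.removeNth m)) := by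
  change ContinuousAlternatingMap.alternatizeUncurryFin T (Matrix.vecCons v m) = _
  rw [ContinuousAlternatingMap.alternatizeUncurryFin_apply, Fin.sum_univ_succ, sub_eq_add_neg,
    ← Finset.sum_neg_distrib]
  congr 1
  · simp
  · refine Finset.sum_congr rfl fun i _ => ?_
    have e : i.succ.removeNth (Matrix.vecCons v m) = Matrix.vecCons v (i.removeNth m) := by
      funext l
      refine Fin.cases ?_ (fun l => ?_) l <;> simp [Fin.removeNth]
    rw [e]
    simp [pow_succ]

theorem extSymbol_zero_apply_vecCons (T : Eucl n →L[ℝ] Form n 0) (v : Eucl n)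
    (m : Fin 0 → Eucl n) : extSymbol n 0 T (Matrix.vecCons v m) = T v m := by
  change ContinuousAlternatingMap.alternatizeUncurryFin T (Matrix.vecCons v m) = _
  rw [ContinuousAlternatingMap.alternatizeUncurryFin_apply]
  simp

variable {F G : Type*} [NormedAddCommGroup F] [NormedSpace ℝ F] [NormedAddCommGroup G]
  [NormedSpace ℝ G]

theorem differentiable_fderiv_of_contDiff_two {β : Eucl n → F} (hβ : ContDiff ℝ 2 β) :
    Differentiable ℝ (fderiv ℝ β) :=
  (hβ.fderiv_right (m := 1) (by norm_num)).differentiable one_ne_zero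

theorem contDiff_one_symbol {β : Eucl n → F} (hβ : ContDiff ℝ 2 β)
    (L : (Eucl n →L[ℝ] F) →L[ℝ] G) : ContDiff ℝ 1 fun x => L (fderiv ℝ β x) :=
  L.contDiff.comp (hβ.fderiv_right (m := 1) (by norm_num))

theorem fderiv_symbol {β : Eucl n → F} (hβ : ContDiff ℝ 2 β)
    (L : (Eucl n →L[ℝ] F) →L[ℝ] G) (x : Eucl n) :
    fderiv ℝ (fun x => L (fderiv ℝ β x)) x = L ∘L fderiv ℝ (fderiv ℝ β) x :=
  (L.hasFDerivAt.comp x (differentiable_fderiv_of_contDiff_two hβ x).hasFDerivAt).fderiv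

theorem fderiv_fderiv_symm {β : Eucl n → F} (hβ : ContDiff ℝ 2 β) (x v w : Eucl n) :
    fderiv ℝ (fderiv ℝ β) x v w = fderiv ℝ (fderiv ℝ β) x w v :=
  (hβ.contDiffAt.isSymmSndFDerivAt (by simp)).eq v w

theorem laplacian_eq {β : Eucl n → F} (hβ : ContDiff ℝ 2 β) (x : Eucl n) :
    laplacian β x = ∑ h, fderiv ℝ (fderiv ℝ β) x (stdFrame n h) (stdFrame n h) := by
  refine Finset.sum_congr rfl fun h _ => ?_
  have := fderiv_symbol hβ (ContinuousLinearMap.apply ℝ F (stdFrame n h)) x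
  exact DFunLike.congr_fun this (stdFrame n h)

theorem contDiff_extDeriv {β : Eucl n → Form n j} (hβ : ContDiff ℝ 2 β) :
    ContDiff ℝ 1 (extDeriv β) := contDiff_one_symbol hβ (extSymbol n j)

theorem contDiff_delta {β : Eucl n → Form n (j + 1)} (hβ : ContDiff ℝ 2 β) :
    ContDiff ℝ 1 (delta β) := by
  rw [funext (delta_eq β)]
  exact contDiff_one_symbol hβ (intSymbol n j)

/-- `dδ + δd` is the Laplacian on forms of positive grade: by `extSymbol_apply_vecCons`, `δd` is the
Laplacian minus the terms of `dδ` with the two derivatives interchanged. -/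
theorem extDeriv_delta_add_delta_extDeriv {β : Eucl n → Form n (j + 1)} (hβ : ContDiff ℝ 2 β)
    (x : Eucl n) : extDeriv (delta β) x + delta (extDeriv β) x = laplacian β x := by
  have e1 := fderiv_symbol hβ (intSymbol n j) x
  have e2 := fderiv_symbol hβ (extSymbol n (j + 1)) x
  rw [← funext (delta_eq β)] at e1
  rw [← funext (extDeriv_eq β)] at e2
  rw [extDeriv_eq, delta_eq, e1, e2, laplacian_eq hβ, intSymbol_apply]
  ext m
  rw [ContinuousAlternatingMap.add_apply, ContinuousAlternatingMap.sum_apply,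
    ContinuousAlternatingMap.sum_apply]
  simp only [ContinuousAlternatingMap.curryLeft_apply_apply, ContinuousLinearMap.comp_apply,
    extSymbol_apply_vecCons, Finset.sum_sub_distrib]
  have h1 : extSymbol n j (intSymbol n j ∘L fderiv ℝ (fderiv ℝ β) x) m =
      ∑ i : Fin (j + 1), ∑ h : Fin n, (-1 : ℤ) ^ (i : ℕ) • fderiv ℝ (fderiv ℝ β) x (m i)
        (stdFrame n h) (Matrix.vecCons (stdFrame n h) (i.removeNth m)) := by
    change ContinuousAlternatingMap.alternatizeUncurryFin _ m = _
    rw [ContinuousAlternatingMap.alternatizeUncurryFin_apply]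
    refine Finset.sum_congr rfl fun i _ => ?_
    rw [ContinuousLinearMap.comp_apply, intSymbol_apply, ContinuousAlternatingMap.sum_apply,
      Finset.smul_sum]
    rfl
  rw [h1, Finset.sum_comm]
  simp only [fun h i => fderiv_fderiv_symm hβ x (stdFrame n h) (m i)]
  abel

/-- `δd` is the Laplacian on functions. -/
theorem delta_extDeriv_zero {β : Eucl n → Form n 0} (hβ : ContDiff ℝ 2 β) (x : Eucl n) :
    delta (extDeriv β) x = laplacian β x := by
  have e2 := fderiv_symbol hβ (extSymbol n 0) x
  rw [← funext (extDeriv_eq β)] at e2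
  rw [delta_eq, e2, laplacian_eq hβ, intSymbol_apply]
  ext m
  rw [ContinuousAlternatingMap.sum_apply, ContinuousAlternatingMap.sum_apply]
  simp only [ContinuousAlternatingMap.curryLeft_apply_apply, ContinuousLinearMap.comp_apply,
    extSymbol_zero_apply_vecCons]

/-- Contractions anticommute. -/
theorem curryLeft_curryLeft_swap (c : Form n (j + 2)) (u v : Eucl n) :
    (c.curryLeft u).curryLeft v = -(c.curryLeft v).curryLeft u := by
  have h := ContinuousAlternatingMap.curryLeft_same c (u + v)
  have e : c.curryLeft (u + v) = c.curryLeft u + c.curryLeft v := map_add _ u v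
  rw [e, ContinuousAlternatingMap.curryLeft_add, add_apply,
    map_add (c.curryLeft u).curryLeft, map_add (c.curryLeft v).curryLeft,
    ContinuousAlternatingMap.curryLeft_same, ContinuousAlternatingMap.curryLeft_same, zero_add,
    add_zero] at h
  exact eq_neg_of_add_eq_zero_left h

/-- `δδ = 0`: second derivatives are symmetric and contractions anticommute. -/
theorem delta_delta {β : Eucl n → Form n (j + 2)} (hβ : ContDiff ℝ 2 β) (x : Eucl n) :
    delta (delta β) x = 0 := by
  have e1 := fderiv_symbol hβ (intSymbol n (j + 1)) x
  rw [← funext (delta_eq β)] at e1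
  have hcl : ∀ (s : Finset (Fin n)) (f : Fin n → Form n (j + 1)),
      (∑ l ∈ s, f l).curryLeft = ∑ l ∈ s, (f l).curryLeft := fun s f =>
    map_sum (ContinuousAlternatingMap.curryLeftLI (𝕜 := ℝ) (E := Eucl n) (F := ℝ)
      (n := j)).toLinearMap f s
  have h : delta (delta β) x = ∑ h, ∑ l, ((fderiv ℝ (fderiv ℝ β) x (stdFrame n h)
      (stdFrame n l)).curryLeft (stdFrame n l)).curryLeft (stdFrame n h) := by
    rw [delta_eq, e1, intSymbol_apply]
    refine Finset.sum_congr rfl fun h _ => ?_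
    rw [ContinuousLinearMap.comp_apply, intSymbol_apply, hcl, sum_apply]
  have h' : delta (delta β) x = -delta (delta β) x := by
    conv_lhs => rw [h, Finset.sum_comm]
    rw [h, ← Finset.sum_neg_distrib]
    refine Finset.sum_congr rfl fun h _ => ?_
    rw [← Finset.sum_neg_distrib]
    refine Finset.sum_congr rfl fun l _ => ?_
    rw [fderiv_fderiv_symm hβ, curryLeft_curryLeft_swap]
  ext m
  exact self_eq_neg.1 (DFunLike.congr_fun h' m)

theorem extDeriv_extDeriv_eq_zero {β : Eucl n → Form n j} (hβ : ContDiff ℝ 2 β) (x : Eucl n) :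
    extDeriv (extDeriv β) x = 0 :=
  congrFun (extDeriv_extDeriv hβ (by simp)) x

end Operators

/-! ### The decomposition and the uniqueness of the solution -/

section Decomposition

variable {n : ℕ} {F G : Type*} [NormedAddCommGroup F] [NormedSpace ℝ F] [CompleteSpace F]
  [NormedAddCommGroup G] [NormedSpace ℝ G] [CompleteSpace G]

theorem sphereArea_pos (hn : 1 ≤ n) : 0 < sphereArea n := by
  have := nontrivial_eucl hn
  rw [sphereArea, Measure.toSphere_real_apply_univ]
  have h1 : 0 < Module.finrank ℝ (Eucl n) := by
    rw [finrank_euclideanSpace_fin]; exact hn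
  have h2 : 0 < (volume : Measure (Eucl n)).real (Metric.ball 0 1) :=
    ENNReal.toReal_pos (Metric.measure_ball_pos volume _ one_pos).ne' measure_ball_lt_top.ne
  positivity

omit [CompleteSpace F] in
theorem newtonPotential_add {γ γ' : Eucl n → F} (h : NewtonConverges γ) (h' : NewtonConverges γ')
    (hγ : Continuous γ) (hγ' : Continuous γ') :
    (newtonPotential fun y => γ y + γ' y) = newtonPotential γ + newtonPotential γ' := by
  funext x
  simp only [newtonPotential, conv, Pi.add_apply, smul_add]
  exact integral_add (h.integrable hγ.aestronglyMeasurable x)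
    (h'.integrable hγ'.aestronglyMeasurable x)

/-- A first-order operator applied to `α` may be put on the potential of `α`, if `α` is cut off at
radius `k + 1` and `k → ∞`: the derivatives that fall on the cutoff disappear in the limit since
`α` vanishes at infinity. -/
theorem tendsto_fderiv_comp_fderiv_newtonPotential (hn : 2 ≤ n) {α : Eucl n → F}
    (hα : ContDiff ℝ 1 α) (h0 : Tendsto α (cocompact (Eucl n)) (𝓝 0))
    (L : (Eucl n →L[ℝ] F) →L[ℝ] G) (h : NewtonConverges fun y => L (fderiv ℝ α y)) (x : Eucl n) :
    Tendsto (fun k => fderiv ℝ (fun z =>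
      L (fderiv ℝ (newtonPotential fun y => cutoffAt k y • α y) z)) x) atTop
      (𝓝 (fderiv ℝ (newtonPotential fun y => L (fderiv ℝ α y)) x)) := by
  have hc : Continuous fun y => L (fderiv ℝ α y) :=
    L.continuous.comp (hα.continuous_fderiv one_ne_zero)
  have e : ∀ k, fderiv ℝ (fun z =>
      L (fderiv ℝ (newtonPotential fun y => cutoffAt k y • α y) z)) x =
      fderiv ℝ (newtonPotential fun y => cutoffAt k y • L (fderiv ℝ α y)) x +
      fderiv ℝ (newtonPotential fun y => L ((fderiv ℝ (cutoffAt k) y).smulRight (α y))) x := by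
    intro k
    have hc1 : Continuous fun y => cutoffAt k y • L (fderiv ℝ α y) :=
      (contDiff_cutoffAt k).continuous.smul hc
    have hc2 : Continuous fun y => L ((fderiv ℝ (cutoffAt k) y).smulRight (α y)) :=
      L.continuous.comp (((ContinuousLinearMap.smulRightL ℝ (Eucl n) F).continuous.comp
        ((contDiff_cutoffAt k).continuous_fderiv one_ne_zero)).clm_apply hα.continuous)
    have hs2 : HasCompactSupport fun y => L ((fderiv ℝ (cutoffAt k) y).smulRight (α y)) :=
      ((hasCompactSupport_cutoffAt k).fderiv ℝ).mono fun y hy hy' => hy (by simp [hy'])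
    have n1 := newtonConverges_of_hasCompactSupport hn hc1 (hasCompactSupport_cutoffAt_smul _ k)
    have n2 := newtonConverges_of_hasCompactSupport hn hc2 hs2
    rw [← newtonPotential_comp_fderiv hn (contDiff_cutoffAt_smul hα k)
      (hasCompactSupport_cutoffAt_smul α k) L]
    simp only [fderiv_cutoffAt_smul hα, map_add, map_smul]
    rw [newtonPotential_add n1 n2 hc1 hc2]
    exact fderiv_add
      ((contDiff_one_newtonPotential hn n1 hc1).differentiable one_ne_zero x)
      ((contDiff_one_newtonPotential hn n2 hc2).differentiable one_ne_zero x)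
  simp only [e]
  simpa using (tendsto_fderiv_newtonPotential_cutoffAt hn h hc x).add
    (tendsto_fderiv_newtonPotential_boundary hn hα.continuous h0 L x)

theorem continuous_extDeriv {j : ℕ} {α : Eucl n → Form n j} (hα : ContDiff ℝ 1 α) :
    Continuous (extDeriv α) :=
  (extSymbol n j).continuous.comp (hα.continuous_fderiv one_ne_zero)

/-- The interior derivative, which is defined by cases on the grade, is a constant-coefficient
first-order operator in every grade. -/
theorem exists_symbol_interiorDeriv (n : ℕ) : ∀ k : ℕ,
    ∃ L : (Eucl n →L[ℝ] Form n k) →L[ℝ] Form n (k - 1),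
      ∀ (β : Eucl n → Form n k) (x : Eucl n), interiorDeriv k β x = L (fderiv ℝ β x)
  | 0 => ⟨0, fun _ _ => rfl⟩
  | j + 1 => ⟨intSymbol n j, delta_eq⟩

theorem continuous_interiorDeriv {k : ℕ} {α : Eucl n → Form n k} (hα : ContDiff ℝ 1 α) :
    Continuous (interiorDeriv k α) := by
  obtain ⟨L, hL⟩ := exists_symbol_interiorDeriv n k
  rw [funext (hL α)]
  exact L.continuous.comp (hα.continuous_fderiv one_ne_zero)

theorem contDiff_interiorDeriv {k : ℕ} {α : Eucl n → Form n k} (hα : ContDiff ℝ 2 α) :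
    ContDiff ℝ 1 (interiorDeriv k α) := by
  obtain ⟨L, hL⟩ := exists_symbol_interiorDeriv n k
  rw [funext (hL α)]
  exact contDiff_one_symbol hα L

theorem contDiff_exteriorDerivTo : ∀ {k : ℕ} {A : Eucl n → Form n (k - 1)}, ContDiff ℝ 2 A →
    ContDiff ℝ 1 (exteriorDerivTo k A)
  | 0, _, _ => contDiff_const
  | j + 1, _, hA => contDiff_extDeriv (j := j) hA

theorem extDeriv_exteriorDerivTo : ∀ {k : ℕ} {A : Eucl n → Form n (k - 1)}, ContDiff ℝ 2 A →
    ∀ x, extDeriv (exteriorDerivTo k A) x = 0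
  | 0, A, _, x => by
    rw [extDeriv_eq]
    change extSymbol n 0 (fderiv ℝ (fun _ => 0) x) = 0
    simp
  | j + 1, A, hA, x => extDeriv_extDeriv_eq_zero (j := j) hA x

theorem interiorDeriv_delta : ∀ {k : ℕ} {B : Eucl n → Form n (k + 1)}, ContDiff ℝ 2 B →
    ∀ x, interiorDeriv k (delta B) x = 0
  | 0, _, _, _ => rfl
  | _ + 1, _, hB, x => delta_delta hB x

/-- The Helmholtz decomposition in terms of Newtonian potentials. -/
theorem exteriorDerivTo_add_delta_newtonPotential (hn : 3 ≤ n) {k : ℕ} {α : Eucl n → Form n k}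
    (hα : ContDiff ℝ 1 α) (h0 : VanishesAtInfinity α) (hδ : PotentialConverges (interiorDeriv k α))
    (hd : PotentialConverges (extDeriv α)) (x : Eucl n) :
    exteriorDerivTo k (newtonPotential (interiorDeriv k α)) x +
      delta (newtonPotential (extDeriv α)) x = -(((n : ℝ) - 2) * sphereArea n) • α x := by
  have hn2 : 2 ≤ n := by omega
  have hN : ∀ l, NewtonConverges fun y => cutoffAt l y • α y := fun l =>
    newtonConverges_of_hasCompactSupport hn2 (contDiff_cutoffAt_smul hα l).continuous
      (hasCompactSupport_cutoffAt_smul α l)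
  have hC2 : ∀ l, ContDiff ℝ 2 (newtonPotential fun y => cutoffAt l y • α y) := fun l =>
    contDiff_two_newtonPotential hn2 (hN l) (contDiff_cutoffAt_smul hα l)
  have hlap : ∀ᶠ l in atTop, laplacian (newtonPotential fun y => cutoffAt l y • α y) x =
      -(((n : ℝ) - 2) * sphereArea n) • α x := by
    filter_upwards [eventually_cutoffAt_eq_one x] with l hl
    rw [laplacian_newtonPotential hn (hN l) (contDiff_cutoffAt_smul hα l), hl, one_smul]
  -- The limit of `δd N (χ_l α) = δ N (d (χ_l α))` is `δ N (dα)`, and similarly for `dδ`.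
  have hT := ((intSymbol n k).continuous.tendsto _).comp
    (tendsto_fderiv_comp_fderiv_newtonPotential hn2 hα h0 (extSymbol n k) hd x)
  cases k with
  | zero =>
    refine tendsto_nhds_unique (f := fun l =>
      laplacian (newtonPotential fun y => cutoffAt l y • α y) x) ?_
      (tendsto_const_nhds.congr' (hlap.mono fun _ h => h.symm))
    simp only [← fun l => delta_extDeriv_zero (hC2 l) x]
    change Tendsto _ _ (𝓝 (0 + delta (newtonPotential (extDeriv α)) x))
    rw [zero_add, delta_eq]
    refine hT.congr fun l => ?_
    rw [delta_eq]
    rfl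
  | succ j =>
    refine tendsto_nhds_unique (f := fun l =>
      laplacian (newtonPotential fun y => cutoffAt l y • α y) x) ?_
      (tendsto_const_nhds.congr' (hlap.mono fun _ h => h.symm))
    simp only [← fun l => extDeriv_delta_add_delta_extDeriv (hC2 l) x]
    have e : delta α = fun y => intSymbol n j (fderiv ℝ α y) := funext (delta_eq α)
    change NewtonConverges (delta α) at hδ
    rw [e] at hδ
    have hT' := ((extSymbol n j).continuous.tendsto _).comp
      (tendsto_fderiv_comp_fderiv_newtonPotential hn2 hα h0 (intSymbol n j) hδ x)
    change Tendsto _ _ (𝓝 (extDeriv (newtonPotential (delta α)) x +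
      delta (newtonPotential (extDeriv α)) x))
    rw [e, delta_eq, extDeriv_eq]
    refine (hT'.add hT).congr fun l => ?_
    rw [delta_eq, extDeriv_eq, funext (delta_eq _)]
    rfl

/-- For a closed density, `dδ` of its Newtonian potential is the Laplacian. -/
theorem extDeriv_delta_newtonPotential (hn : 3 ≤ n) {k : ℕ} {μ : Eucl n → Form n (k + 1)}
    (hμ : ContDiff ℝ 1 μ) (h : NewtonConverges μ) (hd : ∀ x, extDeriv μ x = 0) (x : Eucl n) :
    extDeriv (delta (newtonPotential μ)) x = -(((n : ℝ) - 2) * sphereArea n) • μ x := by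
  have hC2 := contDiff_two_newtonPotential (by omega) h hμ
  rw [← laplacian_newtonPotential hn h hμ, ← extDeriv_delta_add_delta_extDeriv hC2]
  have e : extDeriv (newtonPotential μ) = fun _ => 0 := funext fun y =>
    comp_fderiv_newtonPotential_eq_zero (by omega) h hμ (extSymbol n (k + 1)) hd y
  rw [e, delta_eq (fun _ => 0)]
  simp

/-- For a co-closed density, `δd` of its Newtonian potential is the Laplacian. -/
theorem delta_extDeriv_newtonPotential (hn : 3 ≤ n) {k : ℕ} {ν : Eucl n → Form n k}
    (hν : ContDiff ℝ 1 ν) (h : NewtonConverges ν) (hd : ∀ x, interiorDeriv k ν x = 0)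
    (x : Eucl n) :
    delta (extDeriv (newtonPotential ν)) x = -(((n : ℝ) - 2) * sphereArea n) • ν x := by
  have hC2 := contDiff_two_newtonPotential (by omega) h hν
  rw [← laplacian_newtonPotential hn h hν]
  cases k with
  | zero => exact delta_extDeriv_zero hC2 x
  | succ j =>
    rw [← extDeriv_delta_add_delta_extDeriv hC2]
    have e : delta (newtonPotential ν) = fun _ => 0 := funext fun y => by
      rw [delta_eq]
      exact comp_fderiv_newtonPotential_eq_zero (by omega) h hν (intSymbol n j)
        (fun z => (delta_eq ν z).symm.trans (hd z)) y
    rw [e, extDeriv_eq (fun _ => 0)]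
    simp

theorem DecaysFasterThanInverseSquare.newtonConverges (hn : 2 ≤ n) {j : ℕ}
    {γ : Eucl n → Form n j} (h : DecaysFasterThanInverseSquare γ) (hγ : Continuous γ) :
    NewtonConverges γ := by
  obtain ⟨s, hs, C, hC⟩ := h
  exact newtonConverges_of_decay hn hγ hs hC

omit [CompleteSpace G] in
theorem DecaysFasterThanInverseSquare.tendsto_comp_fderiv (hn : 2 ≤ n) {j : ℕ}
    {γ : Eucl n → Form n j} (h : DecaysFasterThanInverseSquare γ) (hγ : Continuous γ)
    (L : (Eucl n →L[ℝ] Form n j) →L[ℝ] G) :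
    Tendsto (fun x => L (fderiv ℝ (newtonPotential γ) x)) (cocompact (Eucl n)) (𝓝 0) := by
  obtain ⟨s, hs, C, hC⟩ := h
  simpa [Function.comp_def] using
    (L.continuous.tendsto _).comp (tendsto_fderiv_newtonPotential_of_decay hn hγ hs hC)

theorem vanishesAtInfinity_exteriorDerivTo (hn : 2 ≤ n) : ∀ {k : ℕ} {ν : Eucl n → Form n (k - 1)},
    DecaysFasterThanInverseSquare ν → Continuous ν →
    VanishesAtInfinity (exteriorDerivTo k (newtonPotential ν))
  | 0, _, _, _ => tendsto_const_nhds
  | j + 1, _, h, hν => h.tendsto_comp_fderiv hn hν (extSymbol n j)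

theorem vanishesAtInfinity_delta (hn : 2 ≤ n) {k : ℕ} {μ : Eucl n → Form n (k + 1)}
    (h : DecaysFasterThanInverseSquare μ) (hμ : Continuous μ) :
    VanishesAtInfinity (delta (newtonPotential μ)) := by
  rw [funext (delta_eq _)]
  exact h.tendsto_comp_fderiv hn hμ (intSymbol n k)

theorem extDeriv_smul_add {j : ℕ} {A B : Eucl n → Form n j} (hA : ContDiff ℝ 1 A)
    (hB : ContDiff ℝ 1 B) (c : ℝ) (x : Eucl n) :
    extDeriv (fun y => c • (A y + B y)) x = c • (extDeriv A x + extDeriv B x) := by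
  have hA' := hA.differentiable one_ne_zero x
  have hB' := hB.differentiable one_ne_zero x
  rw [extDeriv_eq, extDeriv_eq, extDeriv_eq, fderiv_fun_const_smul (hA'.fun_add hB'),
    fderiv_fun_add hA' hB', map_smul, map_add]

theorem interiorDeriv_smul_add {k : ℕ} {A B : Eucl n → Form n k} (hA : ContDiff ℝ 1 A)
    (hB : ContDiff ℝ 1 B) (c : ℝ) (x : Eucl n) :
    interiorDeriv k (fun y => c • (A y + B y)) x =
      c • (interiorDeriv k A x + interiorDeriv k B x) := by
  obtain ⟨L, hL⟩ := exists_symbol_interiorDeriv n k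
  have hA' := hA.differentiable one_ne_zero x
  have hB' := hB.differentiable one_ne_zero x
  rw [hL, hL, hL, fderiv_fun_const_smul (hA'.fun_add hB'), fderiv_fun_add hA' hB', map_smul,
    map_add]

/-- A form of class `C^1` which is closed, co-closed and vanishes at infinity is zero. -/
theorem eq_zero_of_closed_of_coclosed (hn : 3 ≤ n) {k : ℕ} {α : Eucl n → Form n k}
    (hα : ContDiff ℝ 1 α) (h0 : VanishesAtInfinity α) (hd : ∀ x, extDeriv α x = 0)
    (hδ : ∀ x, interiorDeriv k α x = 0) (x : Eucl n) : α x = 0 := by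
  have hn' : (3 : ℝ) ≤ n := by exact_mod_cast hn
  have hS : ((n : ℝ) - 2) * sphereArea n ≠ 0 :=
    (mul_pos (by linarith) (sphereArea_pos (by omega))).ne'
  have hd' : extDeriv α = fun _ => 0 := funext hd
  have hδ' : interiorDeriv k α = fun _ => 0 := funext hδ
  have hN : ∀ (H : Type) [NormedAddCommGroup H] [NormedSpace ℝ H],
      (newtonPotential fun _ : Eucl n => (0 : H)) = fun _ => 0 := fun H _ _ => by
    funext y
    simp [newtonPotential, conv]
  have h := exteriorDerivTo_add_delta_newtonPotential hn hα h0
    (by rw [hδ']; intro y; simp) (by rw [hd']; intro y; simp) x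
  have h1 : delta (fun _ : Eucl n => (0 : Form n (k + 1))) x = 0 := by simp [delta_eq]
  have h2 : exteriorDerivTo k (fun _ : Eucl n => (0 : Form n (k - 1))) x = 0 := by
    cases k with
    | zero => rfl
    | succ j =>
      change extDeriv (fun _ : Eucl n => (0 : Form n j)) x = 0
      simp [extDeriv_eq]
  rw [hd', hδ', hN, hN, h1, h2, add_zero] at h
  exact (smul_eq_zero.1 h.symm).resolve_left (neg_ne_zero.2 hS)

/-- Uniqueness: the difference of two solutions is closed, co-closed and vanishes at infinity. -/
theorem eq_of_extDeriv_eq_of_interiorDeriv_eq (hn : 3 ≤ n) {k : ℕ} {α β : Eucl n → Form n k}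
    (hα : ContDiff ℝ 1 α) (hβ : ContDiff ℝ 1 β) (hα0 : VanishesAtInfinity α)
    (hβ0 : VanishesAtInfinity β) (hd : ∀ x, extDeriv α x = extDeriv β x)
    (hδ : ∀ x, interiorDeriv k α x = interiorDeriv k β x) : α = β := by
  have hf : ∀ (j : ℕ) (L : (Eucl n →L[ℝ] Form n k) →L[ℝ] Form n j) (x : Eucl n),
      L (fderiv ℝ (α - β) x) = L (fderiv ℝ α x) - L (fderiv ℝ β x) := fun j L x => by
    rw [fderiv_sub (hα.differentiable one_ne_zero x) (hβ.differentiable one_ne_zero x)]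
    exact map_sub L _ _
  refine sub_eq_zero.1 (funext (eq_zero_of_closed_of_coclosed hn (hα.sub hβ) ?_ ?_ ?_))
  · have h := Tendsto.sub hα0 hβ0
    rw [sub_zero] at h
    exact h
  · intro x
    rw [extDeriv_eq, hf, ← extDeriv_eq, ← extDeriv_eq, hd, sub_self]
  · intro x
    obtain ⟨L, hL⟩ := exists_symbol_interiorDeriv n k
    rw [hL, hf, ← hL, ← hL, hδ, sub_self]

end Decomposition

end Kaehler

end

theorem mainTheorem2 (n : ℕ) (hn : 3 ≤ n) (k : ℕ)
    (b : OrthonormalBasis (Fin n) ℝ (Kaehler.Eucl n)) :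
    -- the decomposition
    (∀ α : Kaehler.Eucl n → Kaehler.Form n k,
      ContDiff ℝ 1 α → Kaehler.VanishesAtInfinity α →
      Kaehler.PotentialConverges (Kaehler.interiorDeriv k α) →
      Kaehler.PotentialConverges (extDeriv α) →
        ContDiff ℝ 1 (Kaehler.potential b (Kaehler.interiorDeriv k α)) ∧
        ContDiff ℝ 1 (Kaehler.potential b (extDeriv α)) ∧
        (∀ x, α x = (-(1 / (((n : ℝ) - 2) * Kaehler.sphereArea n))) •
          (Kaehler.exteriorDerivTo k (Kaehler.potential b (Kaehler.interiorDeriv k α)) x +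
            Kaehler.delta (Kaehler.potential b (extDeriv α)) x)) ∧
        -- the first term is closed, the second one is co-closed
        (ContDiff ℝ 2 α →
          ContDiff ℝ 1
            (Kaehler.exteriorDerivTo k (Kaehler.potential b (Kaehler.interiorDeriv k α))) ∧
          ContDiff ℝ 1 (Kaehler.delta (Kaehler.potential b (extDeriv α))) ∧
          (∀ x, extDeriv
            (Kaehler.exteriorDerivTo k (Kaehler.potential b (Kaehler.interiorDeriv k α))) x = 0) ∧
          (∀ x, Kaehler.interiorDeriv k
            (Kaehler.delta (Kaehler.potential b (extDeriv α))) x = 0))) ∧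
    -- the system `dα = μ`, `δα = ν`
    (∀ (μ : Kaehler.Eucl n → Kaehler.Form n (k + 1))
      (ν : Kaehler.Eucl n → Kaehler.Form n (k - 1)),
      ContDiff ℝ 1 μ → ContDiff ℝ 1 ν →
      Kaehler.DecaysFasterThanInverseSquare μ → Kaehler.DecaysFasterThanInverseSquare ν →
      (∀ x, extDeriv μ x = 0) → (∀ x, Kaehler.interiorDeriv (k - 1) ν x = 0) →
      (k = 0 → ν = 0) →
        (ContDiff ℝ 1 (Kaehler.helmholtzForm b k ν μ) ∧
          Kaehler.VanishesAtInfinity (Kaehler.helmholtzForm b k ν μ) ∧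
          (∀ x, extDeriv (Kaehler.helmholtzForm b k ν μ) x = μ x) ∧
          (∀ x, Kaehler.interiorDeriv k (Kaehler.helmholtzForm b k ν μ) x = ν x)) ∧
        ∀ β : Kaehler.Eucl n → Kaehler.Form n k,
          ContDiff ℝ 1 β → Kaehler.VanishesAtInfinity β →
          (∀ x, extDeriv β x = μ x) → (∀ x, Kaehler.interiorDeriv k β x = ν x) →
            β = Kaehler.helmholtzForm b k ν μ) := by
  open Kaehler in
  have hn2 : 2 ≤ n := by omega
  have hn' : (3 : ℝ) ≤ n := by exact_mod_cast hn
  have hS : ((n : ℝ) - 2) * sphereArea n ≠ 0 :=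
    (mul_pos (by linarith) (sphereArea_pos (by omega))).ne'
  have hc : ∀ (j : ℕ) (a : Form n j), (-(1 / (((n : ℝ) - 2) * sphereArea n))) •
      (-(((n : ℝ) - 2) * sphereArea n) • a) = a := fun j a => by
    rw [smul_smul, neg_mul_neg, one_div, inv_mul_cancel₀ hS, one_smul]
  refine ⟨fun α hα h0 hδ hd => ?_, fun μ ν hμ hν hμs hνs hdμ hδν hk => ?_⟩
  · have cδ := continuous_interiorDeriv hα
    have cd := continuous_extDeriv hα
    have eδ := potential_eq_newtonPotential b hδ cδ.aestronglyMeasurable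
    have ed := potential_eq_newtonPotential b hd cd.aestronglyMeasurable
    rw [eδ, ed]
    refine ⟨contDiff_one_newtonPotential hn2 hδ cδ, contDiff_one_newtonPotential hn2 hd cd,
      fun x => ?_, fun hα2 => ?_⟩
    · rw [exteriorDerivTo_add_delta_newtonPotential hn hα h0 hδ hd, hc]
    · have h1 := contDiff_two_newtonPotential hn2 hδ (contDiff_interiorDeriv hα2)
      have h2 := contDiff_two_newtonPotential hn2 hd (contDiff_extDeriv hα2)
      exact ⟨contDiff_exteriorDerivTo h1, contDiff_delta h2, extDeriv_exteriorDerivTo h1,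
        interiorDeriv_delta h2⟩
  · have nμ := hμs.newtonConverges hn2 hμ.continuous
    have nν := hνs.newtonConverges hn2 hν.continuous
    have eH : helmholtzForm b k ν μ = fun x => (-(1 / (((n : ℝ) - 2) * sphereArea n))) •
        (exteriorDerivTo k (newtonPotential ν) x + delta (newtonPotential μ) x) := by
      funext x
      rw [helmholtzForm, potential_eq_newtonPotential b nν hν.continuous.aestronglyMeasurable,
        potential_eq_newtonPotential b nμ hμ.continuous.aestronglyMeasurable]
    have h1 := contDiff_two_newtonPotential hn2 nν hν
    have h2 := contDiff_two_newtonPotential hn2 nμ hμ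
    have c1 := contDiff_exteriorDerivTo h1
    have c2 := contDiff_delta h2
    have HC : ContDiff ℝ 1 (helmholtzForm b k ν μ) := by
      rw [eH]
      exact (c1.add c2).const_smul _
    have H0 : VanishesAtInfinity (helmholtzForm b k ν μ) := by
      rw [eH]
      simpa [VanishesAtInfinity] using
        ((vanishesAtInfinity_exteriorDerivTo hn2 hνs hν.continuous).add
          (vanishesAtInfinity_delta hn2 hμs hμ.continuous)).const_smul
            (-(1 / (((n : ℝ) - 2) * sphereArea n)))
    have Hd : ∀ x, extDeriv (helmholtzForm b k ν μ) x = μ x := fun x => by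
      rw [eH, extDeriv_smul_add c1 c2, extDeriv_exteriorDerivTo h1,
        extDeriv_delta_newtonPotential hn hμ nμ hdμ, zero_add, hc]
    have Hδ : ∀ x, interiorDeriv k (helmholtzForm b k ν μ) x = ν x := fun x => by
      rw [eH, interiorDeriv_smul_add c1 c2, interiorDeriv_delta h2, add_zero]
      cases k with
      | zero =>
        rw [hk rfl]
        exact smul_zero _
      | succ j =>
        exact (congrArg _ (delta_extDeriv_newtonPotential (k := j) hn hν nν hδν x)).trans
          (hc j (ν x))
    exact ⟨⟨HC, H0, Hd, Hδ⟩, fun β hβ hβ0 hβd hβδ =>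
      eq_of_extDeriv_eq_of_interiorDeriv_eq hn hβ HC hβ0 H0 (fun x => (hβd x).trans (Hd x).symm)
        fun x => (hβδ x).trans (Hδ x).symm⟩
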